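/- Consider the controlled pendulum $$\dot x=y,\qquad \dot y=-\sin x+\varepsilon u,\qquad |u|\le 1,$$ on the phase cylinder $T(S^1)=(\mathbb{R}/2\pi\mathbb{Z})\times\mathbb{R}$ with coordinates $(x,y)$, where $\varepsilon>0$ and the controls $u=u(t)$ are measurable functions with values in $[-1,1]$. For $p\in T(S^1)$ let $T_\varepsilon(p)$ be the minimum time in which $p$ can be steered to the lower equilibrium $(0,0)$, and for a nonempty compact set $K\subset T(S^1)$ let $T_\varepsilon(K)=\max_{p\in K}T_\varepsilon(p)$. Theorem. Let $K\subset T(S^1)$ be a nonempty compact set with $K\ne\{(0,0)\}$. Then there exist constants $C_1,C_2,\varepsilon_0>0$, depending only on $K$, such that for all $0<\varepsilon<\varepsilon_0$ the minimum $T_\varepsilon(p)$ exists for every $p\in K$, the maximum $T_\varepsilon(K)$ exists, and $$\frac{C_1}{\varepsilon}\le T_\varepsilon(K)\le\frac{C_2}{\varepsilon}.$$ -/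

import Mathlib

open Set MeasureTheory

noncomputable section

/-- The phase cylinder `T(S¹) = (ℝ/2πℤ) × ℝ`, with points `(x, y)` = (angle, angular velocity). -/
abbrev PhaseSpace : Type := Real.Angle × ℝ

/-- Admissible controls: measurable functions of time with `|u| ≤ 1`. -/
def IsAdmissibleControl (u : ℝ → ℝ) : Prop :=
  Measurable u ∧ ∀ t, |u t| ≤ 1

/-- `γ = (x, y)` solves, on `[0, T]` and in the sense of Carathéodory, the controlled pendulum system
`ẋ = y`, `ẏ = - sin x + ε u`, written in integrated form (the first equation in `ℝ/2πℤ`). -/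
structure IsTrajectory (ε : ℝ) (u : ℝ → ℝ) (T : ℝ) (γ : ℝ → PhaseSpace) : Prop where
  continuousOn : ContinuousOn γ (Icc 0 T)
  angle_eq : ∀ t ∈ Icc (0 : ℝ) T,
    (γ t).1 = (γ 0).1 + ((∫ s in (0 : ℝ)..t, (γ s).2 : ℝ) : Real.Angle)
  velocity_eq : ∀ t ∈ Icc (0 : ℝ) T,
    (γ t).2 = (γ 0).2 + ∫ s in (0 : ℝ)..t, (-Real.Angle.sin (γ s).1 + ε * u s)

/-- The set of all times `T ≥ 0` in which some admissible control steers the state `p` to the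
lower equilibrium `(0, 0)`. -/
def steeringTimes (ε : ℝ) (p : PhaseSpace) : Set ℝ :=
  {T | 0 ≤ T ∧ ∃ (u : ℝ → ℝ) (γ : ℝ → PhaseSpace), IsAdmissibleControl u ∧
    IsTrajectory ε u T γ ∧ γ 0 = p ∧ γ T = (0, 0)}

/-- The minimum damping time from the state `p`. -/
def dampingTime (ε : ℝ) (p : PhaseSpace) : ℝ :=
  sInf (steeringTimes ε p)

/-- `T_ε(K)`: the maximal damping time over all initial states in `K`. -/
def maxDampingTime (ε : ℝ) (K : Set PhaseSpace) : ℝ :=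
  sSup (dampingTime ε '' K)

end

/-- A path of the controlled pendulum lifted to the plane: `W` is the integrated control, which is
`ε`-Lipschitz, and `y - W` has derivative `-sin x`. -/
structure IsLiftedPath (ε T : ℝ) (x y W : ℝ → ℝ) : Prop where
  hasDeriv_angle : ∀ t ∈ Icc 0 T, HasDerivWithinAt x (y t) (Icc 0 T) t
  hasDeriv_velocity : ∀ t ∈ Icc 0 T,
    HasDerivWithinAt (fun s => y s - W s) (-Real.sin (x t)) (Icc 0 T) t
  abs_control_le : ∀ s ∈ Icc 0 T, ∀ t ∈ Icc 0 T, s ≤ t → |W t - W s| ≤ ε * (t - s)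

/-- The state `p` of the lifted system can be steered to `q` in time `T`. -/
def Steers (ε T : ℝ) (p q : ℝ × ℝ) : Prop :=
  0 ≤ T ∧ ∃ x y W : ℝ → ℝ, IsLiftedPath ε T x y W ∧ x 0 = p.1 ∧ y 0 = p.2 ∧ x T = q.1 ∧ y T = q.2

namespace IsLiftedPath

variable {ε T : ℝ} {x y W : ℝ → ℝ}

lemma continuousOn_control (h : IsLiftedPath ε T x y W) : ContinuousOn W (Icc 0 T) := by
  have : LipschitzOnWith (Real.toNNReal |ε|) W (Icc 0 T) := by
    refine LipschitzOnWith.of_dist_le_mul fun s hs t ht => ?_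
    rw [Real.coe_toNNReal _ (abs_nonneg _), Real.dist_eq, Real.dist_eq]
    rcases le_total s t with hst | hst
    · rw [abs_sub_comm, abs_sub_comm s t, abs_of_nonneg (sub_nonneg.2 hst)]
      exact (h.abs_control_le s hs t ht hst).trans
        (mul_le_mul_of_nonneg_right (le_abs_self _) (sub_nonneg.2 hst))
    · rw [abs_of_nonneg (sub_nonneg.2 hst)]
      exact (h.abs_control_le t ht s hs hst).trans
        (mul_le_mul_of_nonneg_right (le_abs_self _) (sub_nonneg.2 hst))
  exact this.continuousOn

lemma continuousOn_angle (h : IsLiftedPath ε T x y W) : ContinuousOn x (Icc 0 T) :=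
  fun t ht => (h.hasDeriv_angle t ht).continuousWithinAt

lemma continuousOn_drift (h : IsLiftedPath ε T x y W) :
    ContinuousOn (fun s => y s - W s) (Icc 0 T) :=
  fun t ht => (h.hasDeriv_velocity t ht).continuousWithinAt

lemma continuousOn_velocity (h : IsLiftedPath ε T x y W) : ContinuousOn y (Icc 0 T) := by
  have := h.continuousOn_drift.add h.continuousOn_control
  exact this.congr fun t _ => by simp

lemma mono (h : IsLiftedPath ε T x y W) {S : ℝ} (hS : S ≤ T) : IsLiftedPath ε S x y W := by
  have hss : Icc 0 S ⊆ Icc 0 T := Icc_subset_Icc_right hS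
  exact ⟨fun t ht => (h.hasDeriv_angle t (hss ht)).mono hss,
    fun t ht => (h.hasDeriv_velocity t (hss ht)).mono hss,
    fun s hs t ht => h.abs_control_le s (hss hs) t (hss ht)⟩

lemma add_const (h : IsLiftedPath ε T x y W) {c : ℝ} (hc : ∀ r, Real.sin (r + c) = Real.sin r) :
    IsLiftedPath ε T (fun t => x t + c) y W :=
  ⟨fun t ht => (h.hasDeriv_angle t ht).add_const c,
    fun t ht => by simpa [hc] using h.hasDeriv_velocity t ht, h.abs_control_le⟩

lemma neg (h : IsLiftedPath ε T x y W) :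
    IsLiftedPath ε T (fun t => -x t) (fun t => -y t) (fun t => -W t) := by
  refine ⟨fun t ht => (h.hasDeriv_angle t ht).neg, fun t ht => ?_, fun s hs t ht hst => ?_⟩
  · have := (h.hasDeriv_velocity t ht).neg
    rw [Real.sin_neg]
    refine this.congr_of_eventuallyEq_of_mem (Filter.Eventually.of_forall fun s => ?_) ht
    simp only [Pi.neg_apply]; ring
  · have := h.abs_control_le s hs t ht hst
    rwa [← abs_neg, show -(-W t - -W s) = W t - W s by ring]

/-- A path with differentiable velocity and `|y' + sin x| ≤ ε`. -/
lemma of_hasDerivWithinAt {y' : ℝ → ℝ}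
    (hx : ∀ t ∈ Icc 0 T, HasDerivWithinAt x (y t) (Icc 0 T) t)
    (hy : ∀ t ∈ Icc 0 T, HasDerivWithinAt y (y' t) (Icc 0 T) t)
    (hε : ∀ t ∈ Icc 0 T, |y' t + Real.sin (x t)| ≤ ε) :
    ∃ W, IsLiftedPath ε T x y W := by
  rcases lt_or_ge T 0 with hT | hT
  · exact ⟨0, by constructor <;> simp [Icc_eq_empty_of_lt hT]⟩
  have hxc : Continuous (fun s => Real.sin (x (projIcc 0 T hT s))) := by
    have : ContinuousOn x (Icc 0 T) := fun t ht => (hx t ht).continuousWithinAt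
    exact Real.continuous_sin.comp
      ((continuousOn_iff_continuous_domRestrict.1 this).comp continuous_projIcc)
  have hS : ∀ t ∈ Icc 0 T, HasDerivWithinAt
      (fun t => ∫ s in (0 : ℝ)..t, Real.sin (x (projIcc 0 T hT s))) (Real.sin (x t)) (Icc 0 T) t := by
    intro t ht
    have := (hxc.integral_hasStrictDerivAt 0 t).hasDerivAt.hasDerivWithinAt (s := Icc 0 T)
    simpa [projIcc_of_mem hT ht] using this
  set S := fun t => ∫ s in (0 : ℝ)..t, Real.sin (x (projIcc 0 T hT s))
  refine ⟨fun t => y t + S t, hx, fun t ht => ?_, fun s hs t ht hst => ?_⟩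
  · refine (hS t ht).neg.congr_of_eventuallyEq_of_mem (Filter.Eventually.of_forall fun s => ?_) ht
    simp
  · have := (convex_Icc (0 : ℝ) T).norm_image_sub_le_of_norm_hasDerivWithin_le
      (fun r hr => (hy r hr).add (hS r hr)) (fun r hr => hε r hr) hs ht
    simpa [Real.norm_eq_abs, abs_of_nonneg (sub_nonneg.2 hst)] using this

end IsLiftedPath

/-- Run along `f` up to time `a`, and from then on along `g`. -/
noncomputable def concatAt {α : Type*} (a : ℝ) (f g : ℝ → α) (t : ℝ) : α :=
  if t ≤ a then f t else g (t - a)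

section concatAt

variable {a b : ℝ} {f g : ℝ → ℝ}

lemma concatAt_of_le {α : Type*} {f g : ℝ → α} {t : ℝ} (ht : t ≤ a) : concatAt a f g t = f t := by
  simp [concatAt, ht]

lemma concatAt_of_ge {α : Type*} {f g : ℝ → α} (h : f a = g 0) {t : ℝ} (ht : a ≤ t) :
    concatAt a f g t = g (t - a) := by
  rcases ht.eq_or_lt with rfl | ht
  · simp [concatAt, h]
  · simp [concatAt, ht.not_ge]

lemma hasDerivWithinAt_concatAt {f' g' : ℝ → ℝ} (ha : 0 ≤ a) (hb : 0 ≤ b)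
    (hf : ∀ t ∈ Icc 0 a, HasDerivWithinAt f (f' t) (Icc 0 a) t)
    (hg : ∀ t ∈ Icc 0 b, HasDerivWithinAt g (g' t) (Icc 0 b) t)
    (h : f a = g 0) (h' : f' a = g' 0) :
    ∀ t ∈ Icc 0 (a + b),
      HasDerivWithinAt (concatAt a f g) (concatAt a f' g' t) (Icc 0 (a + b)) t := by
  intro t ht
  rw [← Icc_union_Icc_eq_Icc ha (le_add_of_nonneg_right hb)]
  refine HasDerivWithinAt.union ?_ ?_
  · by_cases hta : t ≤ a
    · rw [concatAt_of_le hta]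
      exact (hf t ⟨ht.1, hta⟩).congr (fun s hs => concatAt_of_le hs.2) (concatAt_of_le hta)
    · refine HasFDerivWithinAt.of_notMem_closure ?_
      rw [isClosed_Icc.closure_eq]
      exact fun hh => hta hh.2
  · by_cases hta : a ≤ t
    · rw [concatAt_of_ge h' hta]
      have hmem : t - a ∈ Icc 0 b := ⟨sub_nonneg.2 hta, by linarith [ht.2]⟩
      have := (hg (t - a) hmem).scomp_of_eq (h := fun s => s - a) t
        (((hasDerivAt_id t).sub_const a).hasDerivWithinAt (s := Icc a (a + b)))
        (fun s hs => ⟨sub_nonneg.2 hs.1, by linarith [hs.2]⟩) rfl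
      rw [one_smul] at this
      exact this.congr (fun s hs => concatAt_of_ge h hs.1) (concatAt_of_ge h hta)
    · refine HasFDerivWithinAt.of_notMem_closure ?_
      rw [isClosed_Icc.closure_eq]
      exact fun hh => hta hh.1

end concatAt

namespace Steers

variable {ε S T : ℝ} {p q r : ℝ × ℝ}

lemma trans (h₁ : Steers ε S p q) (h₂ : Steers ε T q r) : Steers ε (S + T) p r := by
  obtain ⟨hS, x, y, W, h, hx0, hy0, hxS, hyS⟩ := h₁
  obtain ⟨hT, x', y', W', h', hx0', hy0', hxT, hyT⟩ := h₂
  have ex : x S = x' 0 := by rw [hxS, hx0']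
  have ey : y S = y' 0 := by rw [hyS, hy0']
  set W'' : ℝ → ℝ := fun t => W' t - W' 0 + W S with hW''
  have eW : W S = W'' 0 := by simp [hW'']
  refine ⟨add_nonneg hS hT, concatAt S x x', concatAt S y y', concatAt S W W'',
    ⟨?_, ?_, ?_⟩, ?_, ?_, ?_, ?_⟩
  · exact hasDerivWithinAt_concatAt hS hT h.hasDeriv_angle h'.hasDeriv_angle ex ey
  · intro t ht
    have key := hasDerivWithinAt_concatAt hS hT h.hasDeriv_velocity
      (g := fun t => y' t - W'' t) (g' := fun t => -Real.sin (x' t)) (fun t ht => by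
        have := (h'.hasDeriv_velocity t ht).add_const (W' 0 - W S)
        refine this.congr_of_eventuallyEq_of_mem (Filter.Eventually.of_forall fun s => ?_) ht
        simp [hW'']; ring) (by simp [hW'', ey]) (by simp [ex]) t ht
    have e1 : -Real.sin (concatAt S x x' t)
        = concatAt S (fun t => -Real.sin (x t)) (fun t => -Real.sin (x' t)) t := by
      unfold concatAt; split_ifs <;> rfl
    rw [e1]
    refine key.congr_of_eventuallyEq_of_mem (Filter.Eventually.of_forall fun s => ?_) ht
    unfold concatAt; dsimp only; split_ifs <;> rfl
  · have A : ∀ s ∈ Icc 0 S, ∀ t ∈ Icc 0 S, s ≤ t →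
        |concatAt S W W'' t - concatAt S W W'' s| ≤ ε * (t - s) := by
      intro s hs t ht hst
      rw [concatAt_of_le hs.2, concatAt_of_le ht.2]
      exact h.abs_control_le s hs t ht hst
    have B : ∀ s ∈ Icc S (S + T), ∀ t ∈ Icc S (S + T), s ≤ t →
        |concatAt S W W'' t - concatAt S W W'' s| ≤ ε * (t - s) := by
      intro s hs t ht hst
      rw [concatAt_of_ge eW hs.1, concatAt_of_ge eW ht.1]
      have := h'.abs_control_le (s - S) ⟨by linarith [hs.1], by linarith [hs.2]⟩ (t - S)
        ⟨by linarith [ht.1], by linarith [ht.2]⟩ (by linarith)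
      simpa [hW''] using this
    intro s hs t ht hst
    rcases le_total t S with htS | htS
    · exact A s ⟨hs.1, hst.trans htS⟩ t ⟨ht.1, htS⟩ hst
    rcases le_total s S with hsS | hsS
    · have a1 := A s ⟨hs.1, hsS⟩ S ⟨hS, le_rfl⟩ hsS
      have a2 := B S ⟨le_rfl, by linarith⟩ t ⟨htS, ht.2⟩ htS
      have a3 := abs_sub_le (concatAt S W W'' t) (concatAt S W W'' S) (concatAt S W W'' s)
      linarith
    · exact B s ⟨hsS, hs.2⟩ t ⟨htS, ht.2⟩ hst
  · rw [concatAt_of_le hS, hx0]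
  · rw [concatAt_of_le hS, hy0]
  · rw [concatAt_of_ge ex (by linarith), add_sub_cancel_left, hxT]
  · rw [concatAt_of_ge ey (by linarith), add_sub_cancel_left, hyT]

lemma add_const (h : Steers ε T p q) {c : ℝ} (hc : ∀ r, Real.sin (r + c) = Real.sin r) :
    Steers ε T (p.1 + c, p.2) (q.1 + c, q.2) := by
  obtain ⟨hT, x, y, W, h, hx0, hy0, hxT, hyT⟩ := h
  exact ⟨hT, _, y, W, h.add_const hc, by simp [hx0], hy0, by simp [hxT], hyT⟩

lemma neg (h : Steers ε T p q) : Steers ε T (-p) (-q) := by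
  obtain ⟨hT, x, y, W, h, hx0, hy0, hxT, hyT⟩ := h
  exact ⟨hT, _, _, _, h.neg, by simp [hx0], by simp [hy0], by simp [hxT], by simp [hyT]⟩

lemma rest (hε : 0 ≤ ε) (hT : 0 ≤ T) {c : ℝ} (hc : Real.sin c = 0) :
    Steers ε T (c, 0) (c, 0) := by
  refine ⟨hT, fun _ => c, fun _ => 0, fun _ => 0, ⟨?_, ?_, ?_⟩, rfl, rfl, rfl, rfl⟩
  · intro t ht; simpa using hasDerivWithinAt_const t (Icc 0 T) c
  · intro t ht; simpa [hc] using hasDerivWithinAt_const t (Icc 0 T) (0 : ℝ)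
  · intro s hs t ht hst
    simpa using mul_nonneg hε (sub_nonneg.2 hst)

end Steers

/-- The state `p` of the lifted system can be steered to a lift of `(0, 0)` in time `T`. -/
def Damps (ε T : ℝ) (p : ℝ × ℝ) : Prop :=
  ∃ k : ℤ, Steers ε T p (k * (2 * Real.pi), 0)

lemma IsLiftedPath.integral_velocity {ε T : ℝ} {x y W : ℝ → ℝ} (h : IsLiftedPath ε T x y W)
    {t : ℝ} (ht : t ∈ Icc 0 T) : ∫ s in (0 : ℝ)..t, y s = x t - x 0 := by
  have hss : Icc 0 t ⊆ Icc 0 T := Icc_subset_Icc_right ht.2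
  refine intervalIntegral.integral_eq_sub_of_hasDerivAt_of_le ht.1 (h.continuousOn_angle.mono hss)
    (fun s hs => ?_) ((h.continuousOn_velocity.mono hss).intervalIntegrable_of_Icc ht.1)
  exact (h.hasDeriv_angle s ⟨hs.1.le, hs.2.le.trans ht.2⟩).hasDerivAt
    (Icc_mem_nhds hs.1 (hs.2.trans_le ht.2))

lemma IsLiftedPath.integral_neg_sin {ε T : ℝ} {x y W : ℝ → ℝ} (h : IsLiftedPath ε T x y W)
    {t : ℝ} (ht : t ∈ Icc 0 T) :
    ∫ s in (0 : ℝ)..t, -Real.sin (x s) = (y t - W t) - (y 0 - W 0) := by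
  have hss : Icc 0 t ⊆ Icc 0 T := Icc_subset_Icc_right ht.2
  refine intervalIntegral.integral_eq_sub_of_hasDerivAt_of_le ht.1 (h.continuousOn_drift.mono hss)
    (fun s hs => ?_) ?_
  · exact (h.hasDeriv_velocity s ⟨hs.1.le, hs.2.le.trans ht.2⟩).hasDerivAt
      (Icc_mem_nhds hs.1 (hs.2.trans_le ht.2))
  · exact ((Real.continuous_sin.comp_continuousOn
      (h.continuousOn_angle.mono hss)).neg).intervalIntegrable_of_Icc ht.1

lemma IsLiftedPath.exists_control {ε T : ℝ} (hε : 0 < ε) (hT : 0 ≤ T) {x y W : ℝ → ℝ}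
    (h : IsLiftedPath ε T x y W) :
    ∃ u, IsAdmissibleControl u ∧ IsTrajectory ε u T (fun t => ((x t : Real.Angle), y t)) := by
  set V : ℝ → ℝ := fun t => W (projIcc 0 T hT t) with hV
  have hVL : LipschitzWith ⟨ε, hε.le⟩ V := by
    have key : ∀ s t, s ≤ t → |V t - V s| ≤ ε * (t - s) := by
      intro s t hst
      have hm : projIcc 0 T hT s ≤ projIcc 0 T hT t := monotone_projIcc hT hst
      have h1 := h.abs_control_le _ (projIcc 0 T hT s).2 _ (projIcc 0 T hT t).2 hm
      have h2 := (LipschitzWith.projIcc hT).dist_le_mul t s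
      rw [Subtype.dist_eq, Real.dist_eq, Real.dist_eq, abs_of_nonneg (sub_nonneg.2 hst),
        NNReal.coe_one, one_mul] at h2
      exact h1.trans (mul_le_mul_of_nonneg_left ((le_abs_self _).trans h2) hε.le)
    refine LipschitzWith.of_dist_le_mul fun s t => ?_
    change dist (V s) (V t) ≤ ε * dist s t
    rw [Real.dist_eq, Real.dist_eq]
    rcases le_total s t with hst | hst
    · rw [abs_sub_comm, abs_sub_comm s t, abs_of_nonneg (sub_nonneg.2 hst)]
      exact key s t hst
    · rw [abs_of_nonneg (sub_nonneg.2 hst)]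
      exact key t s hst
  have hVW : ∀ t ∈ Icc 0 T, V t = W t := fun t ht => by simp [hV, projIcc_of_mem hT ht]
  have hAC : ∀ t, AbsolutelyContinuousOnInterval V 0 t := fun t =>
    (hVL.lipschitzOnWith (s := uIcc 0 t)).absolutelyContinuousOnInterval
  refine ⟨fun t => deriv V t / ε, ⟨(measurable_deriv V).div_const ε, fun t => ?_⟩, ?_, ?_, ?_⟩
  · have : ‖deriv V t‖ ≤ ε := norm_deriv_le_of_lipschitz hVL
    rw [abs_div, abs_of_pos hε, div_le_one hε]
    exact this
  · exact (Real.Angle.continuous_coe.comp_continuousOn h.continuousOn_angle).prodMk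
      h.continuousOn_velocity
  · intro t ht
    dsimp only
    rw [h.integral_velocity ht, ← Real.Angle.coe_add]
    congr 1; ring
  · intro t ht
    dsimp only
    have hi : IntervalIntegrable (fun s => -Real.sin (x s)) volume 0 t :=
      ((Real.continuous_sin.comp_continuousOn (h.continuousOn_angle.mono
        (Icc_subset_Icc_right ht.2))).neg).intervalIntegrable_of_Icc ht.1
    have e : (fun s => -Real.Angle.sin (x s : Real.Angle) + ε * (deriv V s / ε))
        = fun s => -Real.sin (x s) + deriv V s := by
      funext s
      rw [Real.Angle.sin_coe, mul_div_cancel₀ _ hε.ne']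
    rw [e, intervalIntegral.integral_add hi (hAC t).intervalIntegrable_deriv,
      (hAC t).integral_deriv_eq_sub, h.integral_neg_sin ht, hVW t ht,
      hVW 0 ⟨le_rfl, ht.1.trans ht.2⟩]
    ring

lemma IsTrajectory.exists_isLiftedPath {ε T : ℝ} (hε : 0 < ε) (hT : 0 ≤ T) {u : ℝ → ℝ}
    {γ : ℝ → PhaseSpace} (hu : IsAdmissibleControl u) (h : IsTrajectory ε u T γ) {a : ℝ}
    (ha : (γ 0).1 = (a : Real.Angle)) :
    ∃ x W : ℝ → ℝ, IsLiftedPath ε T x (fun t => (γ t).2) W ∧ x 0 = a ∧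
      ∀ t ∈ Icc 0 T, (γ t).1 = (x t : Real.Angle) := by
  have hyc : ContinuousOn (fun t => (γ t).2) (Icc 0 T) := continuous_snd.comp_continuousOn h.continuousOn
  have hsc : ContinuousOn (fun t => -Real.Angle.sin (γ t).1) (Icc 0 T) :=
    (Real.Angle.continuous_sin.comp_continuousOn
      (continuous_fst.comp_continuousOn h.continuousOn)).neg
  have hui : ∀ s t, IntervalIntegrable u volume s t := fun s t => by
    refine (intervalIntegrable_const (c := (1 : ℝ))).mono_fun hu.1.aestronglyMeasurable ?_
    exact Filter.Eventually.of_forall fun r => by simpa using hu.2 r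
  have hprim : ∀ g : ℝ → ℝ, ContinuousOn g (Icc 0 T) → ∀ t ∈ Icc 0 T,
      HasDerivWithinAt (fun t => ∫ s in (0 : ℝ)..t, g s) (g t) (Icc 0 T) t := by
    intro g hg t ht
    set G : ℝ → ℝ := fun s => g (projIcc 0 T hT s) with hG
    have hGc : Continuous G :=
      (continuousOn_iff_continuous_domRestrict.1 hg).comp continuous_projIcc
    have h1 := (hGc.integral_hasStrictDerivAt 0 t).hasDerivAt.hasDerivWithinAt (s := Icc 0 T)
    have h2 : ∀ t ∈ Icc 0 T, ∫ s in (0 : ℝ)..t, g s = ∫ s in (0 : ℝ)..t, G s := by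
      intro t ht
      refine intervalIntegral.integral_congr fun s hs => ?_
      rw [uIcc_of_le ht.1] at hs
      simp [hG, projIcc_of_mem hT ⟨hs.1, hs.2.trans ht.2⟩]
    have h3 : G t = g t := by simp [hG, projIcc_of_mem hT ht]
    rw [← h3]
    exact h1.congr h2 (h2 t ht)
  set x : ℝ → ℝ := fun t => a + ∫ s in (0 : ℝ)..t, (γ s).2 with hx
  have hγx : ∀ t ∈ Icc 0 T, (γ t).1 = (x t : Real.Angle) := fun t ht => by
    rw [h.angle_eq t ht, ha, hx, Real.Angle.coe_add]
  refine ⟨x, fun t => ε * ∫ s in (0 : ℝ)..t, u s, ⟨?_, ?_, ?_⟩, by simp [hx], hγx⟩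
  · intro t ht
    exact (hprim _ hyc t ht).const_add a
  · intro t ht
    rw [← Real.Angle.sin_coe, ← hγx t ht]
    have key : ∀ t ∈ Icc 0 T, (γ t).2 - ε * ∫ s in (0 : ℝ)..t, u s
        = (γ 0).2 + ∫ s in (0 : ℝ)..t, -Real.Angle.sin (γ s).1 := by
      intro t ht
      rw [h.velocity_eq t ht, intervalIntegral.integral_add, intervalIntegral.integral_const_mul]
      · ring
      · exact (hsc.mono (Icc_subset_Icc_right ht.2)).intervalIntegrable_of_Icc ht.1
      · exact (hui 0 t).const_mul ε
    exact ((hprim _ hsc t ht).const_add _).congr key (key t ht)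
  · intro s hs t ht hst
    rw [← mul_sub, intervalIntegral.integral_interval_sub_left (hui _ _) (hui _ _), abs_mul,
      abs_of_pos hε]
    refine mul_le_mul_of_nonneg_left ?_ hε.le
    have := intervalIntegral.norm_integral_le_of_norm_le_const (a := s) (b := t) (C := 1) (f := u)
      fun r _ => hu.2 r
    simpa [Real.norm_eq_abs, abs_of_nonneg (sub_nonneg.2 hst)] using this

lemma mem_steeringTimes_iff {ε : ℝ} (hε : 0 < ε) {T : ℝ} {p : ℝ × ℝ} :
    T ∈ steeringTimes ε ((p.1 : Real.Angle), p.2) ↔ Damps ε T p := by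
  constructor
  · rintro ⟨hT, u, γ, hu, hγ, h0, h1⟩
    obtain ⟨x, W, h, hx0, hx⟩ := hγ.exists_isLiftedPath hε hT hu (a := p.1) (by rw [h0])
    have hxT := hx T ⟨hT, le_rfl⟩
    rw [h1] at hxT
    obtain ⟨k, hk⟩ := Real.Angle.coe_eq_zero_iff.1 hxT.symm
    refine ⟨k, hT, x, _, W, h, hx0, by simp [h0], ?_, by simp [h1]⟩
    simp [← hk]
  · rintro ⟨k, hT, x, y, W, h, hx0, hy0, hxT, hyT⟩
    obtain ⟨u, hu, hγ⟩ := h.exists_control hε hT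
    refine ⟨hT, u, _, hu, hγ, by simp [hx0, hy0], ?_⟩
    have : (x T : Real.Angle) = 0 := Real.Angle.coe_eq_zero_iff.2 ⟨k, by simp [hxT]⟩
    simp [this, hyT]

lemma sin_add_int_mul_two_pi_eq (k : ℤ) (r : ℝ) :
    Real.sin (r + k * (2 * Real.pi)) = Real.sin r := Real.sin_add_int_mul_two_pi r k

namespace Damps

variable {ε S T : ℝ} {p q : ℝ × ℝ}

lemma of_steers (h₁ : Steers ε S p q) (h₂ : Damps ε T q) : Damps ε (S + T) p := by
  obtain ⟨k, hk⟩ := h₂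
  exact ⟨k, h₁.trans hk⟩

lemma nonneg (h : Damps ε T p) : 0 ≤ T := by
  obtain ⟨k, hk⟩ := h
  exact hk.1

lemma mono (hε : 0 ≤ ε) (h : Damps ε S p) (hST : S ≤ T) : Damps ε T p := by
  obtain ⟨k, hk⟩ := h
  refine ⟨k, ?_⟩
  have := hk.trans (Steers.rest hε (sub_nonneg.2 hST)
    (c := k * (2 * Real.pi)) (by simpa using sin_add_int_mul_two_pi_eq k 0))
  rwa [add_sub_cancel] at this

lemma neg (h : Damps ε T p) : Damps ε T (-p) := by
  obtain ⟨k, hk⟩ := h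
  refine ⟨-k, ?_⟩
  simpa using hk.neg

lemma add_int (h : Damps ε T p) (n : ℤ) : Damps ε T (p.1 + n * (2 * Real.pi), p.2) := by
  obtain ⟨k, hk⟩ := h
  refine ⟨k + n, ?_⟩
  have := hk.add_const (c := n * (2 * Real.pi)) (fun r => sin_add_int_mul_two_pi_eq n r)
  simpa [add_mul] using this

lemma add_int_iff (n : ℤ) {a b : ℝ} : Damps ε T (a + n * (2 * Real.pi), b) ↔ Damps ε T (a, b) :=
  ⟨fun h => by simpa using h.add_int (-n), fun h => h.add_int n⟩

end Damps

lemma abs_sub_le_of_hasDerivWithinAt {T K : ℝ} {f f' : ℝ → ℝ}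
    (hf : ∀ t ∈ Icc 0 T, HasDerivWithinAt f (f' t) (Icc 0 T) t)
    (hK : ∀ t ∈ Icc 0 T, |f' t| ≤ K) {s t : ℝ} (hs : s ∈ Icc 0 T) (ht : t ∈ Icc 0 T) :
    |f t - f s| ≤ K * |t - s| :=
  (convex_Icc (0 : ℝ) T).norm_image_sub_le_of_norm_hasDerivWithin_le hf hK hs ht

lemma abs_sub_sub_mul_le_of_hasDerivWithinAt {T K : ℝ} {f f' : ℝ → ℝ} (hK0 : 0 ≤ K)
    (hf : ∀ t ∈ Icc 0 T, HasDerivWithinAt f (f' t) (Icc 0 T) t)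
    (hK : ∀ s ∈ Icc 0 T, ∀ t ∈ Icc 0 T, |f' t - f' s| ≤ K * |t - s|)
    {s t : ℝ} (hs : s ∈ Icc 0 T) (ht : t ∈ Icc 0 T) :
    |f t - f s - f' s * (t - s)| ≤ K * (t - s) ^ 2 := by
  have hsub : uIcc s t ⊆ Icc 0 T := uIcc_subset_Icc hs ht
  have hder : ∀ r ∈ uIcc s t,
      HasDerivWithinAt (fun r => f r - f' s * r) (f' r - f' s) (uIcc s t) r := fun r hr => by
    have := ((hf r (hsub hr)).mono hsub).sub ((hasDerivWithinAt_id r (uIcc s t)).const_mul (f' s))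
    rwa [mul_one] at this
  have hbd : ∀ r ∈ uIcc s t, ‖f' r - f' s‖ ≤ K * |t - s| := fun r hr =>
    (hK s hs r (hsub hr)).trans (mul_le_mul_of_nonneg_left
      (abs_sub_left_of_mem_uIcc hr) hK0)
  have := (convex_uIcc s t).norm_image_sub_le_of_norm_hasDerivWithin_le hder hbd
    left_mem_uIcc right_mem_uIcc
  rw [Real.norm_eq_abs, Real.norm_eq_abs, mul_assoc, ← sq, sq_abs] at this
  convert this using 2
  ring

lemma hasDerivWithinAt_of_abs_le_sq {K a d : ℝ} {f : ℝ → ℝ} {S : Set ℝ}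
    (h : ∀ t ∈ S, |f t - f a - d * (t - a)| ≤ K * (t - a) ^ 2) : HasDerivWithinAt f d S a := by
  rw [hasDerivWithinAt_iff_isLittleO]
  have h1 : (fun t => f t - f a - (t - a) • d) =O[nhdsWithin a S] fun t => (t - a) ^ 2 := by
    refine Asymptotics.IsBigO.of_bound K ?_
    filter_upwards [self_mem_nhdsWithin] with t ht
    rw [smul_eq_mul, mul_comm, Real.norm_eq_abs, Real.norm_eq_abs, abs_of_nonneg (sq_nonneg (t - a))]
    exact h t ht
  have h2 : (fun t : ℝ => (t - a) ^ 2) =o[nhdsWithin a S] fun t => t - a := by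
    have h3 : Filter.Tendsto (fun t : ℝ => t - a) (nhdsWithin a S) (nhds 0) := by
      have : ContinuousWithinAt (fun t : ℝ => t - a) S a := by fun_prop
      simpa [ContinuousWithinAt] using this
    exact (Asymptotics.isLittleO_pow_id one_lt_two).comp_tendsto h3
  exact h1.trans_isLittleO h2

namespace IsLiftedPath

variable {ε T : ℝ} {x y W : ℝ → ℝ}

lemma abs_control_sub_le (h : IsLiftedPath ε T x y W) {s t : ℝ}
    (hs : s ∈ Icc 0 T) (ht : t ∈ Icc 0 T) : |W t - W s| ≤ ε * |t - s| := by
  rcases le_total s t with hst | hst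
  · rw [abs_of_nonneg (sub_nonneg.2 hst)]
    exact h.abs_control_le s hs t ht hst
  · rw [abs_sub_comm, abs_sub_comm t, abs_of_nonneg (sub_nonneg.2 hst)]
    exact h.abs_control_le t ht s hs hst

lemma abs_velocity_sub_le (h : IsLiftedPath ε T x y W) {s t : ℝ}
    (hs : s ∈ Icc 0 T) (ht : t ∈ Icc 0 T) : |y t - y s| ≤ (1 + ε) * |t - s| := by
  have h1 := abs_sub_le_of_hasDerivWithinAt h.hasDeriv_velocity (K := 1)
    (fun r _ => by rw [abs_neg]; exact Real.abs_sin_le_one _) hs ht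
  have h2 := h.abs_control_sub_le hs ht
  have h3 := abs_add_le ((y t - W t) - (y s - W s)) (W t - W s)
  rw [show (y t - W t) - (y s - W s) + (W t - W s) = y t - y s by ring] at h3
  linarith

lemma abs_velocity_le (h : IsLiftedPath ε T x y W) (hε : 0 ≤ ε) {t : ℝ} (ht : t ∈ Icc 0 T) :
    |y t| ≤ |y 0| + (1 + ε) * T := by
  have h1 := h.abs_velocity_sub_le ⟨le_rfl, ht.1.trans ht.2⟩ ht
  have h2 := abs_sub_abs_le_abs_sub (y t) (y 0)
  rw [sub_zero, abs_of_nonneg ht.1] at h1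
  have := mul_le_mul_of_nonneg_left ht.2 (by linarith : 0 ≤ 1 + ε)
  linarith

lemma control_add_const (h : IsLiftedPath ε T x y W) (c : ℝ) :
    IsLiftedPath ε T x y (fun t => W t + c) := by
  refine ⟨h.hasDeriv_angle, fun t ht => ?_, fun s hs t ht hst => ?_⟩
  · refine ((h.hasDeriv_velocity t ht).sub_const c).congr_of_eventuallyEq_of_mem
      (Filter.Eventually.of_forall fun s => ?_) ht
    simp only; ring
  · simpa using h.abs_control_le s hs t ht hst

end IsLiftedPath

open Filter Topology in
/-- Sequential compactness of the set of paths with a given initial state. -/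
lemma exists_tendsto_isLiftedPath {ε T a b : ℝ} (hε : 0 ≤ ε) (hT : 0 ≤ T) {x y W : ℕ → ℝ → ℝ}
    (h : ∀ n, IsLiftedPath ε T (x n) (y n) (W n)) (hx0 : ∀ n, x n 0 = a) (hy0 : ∀ n, y n 0 = b) :
    ∃ X Y Z, IsLiftedPath ε T X Y Z ∧ X 0 = a ∧ Y 0 = b ∧
      Tendsto (fun n => x n T) (hyperfilter ℕ : Filter ℕ) (𝓝 (X T)) ∧
      Tendsto (fun n => y n T) (hyperfilter ℕ : Filter ℕ) (𝓝 (Y T)) := by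
  wlog hW0 : ∀ n, W n 0 = 0 generalizing W
  · exact this (fun n => (h n).control_add_const (-W n 0)) (fun n => by simp)
  have h0 : (0 : ℝ) ∈ Icc 0 T := ⟨le_rfl, hT⟩
  have lim : ∀ {f : ℕ → ℝ → ℝ} {C : ℝ}, (∀ n, ∀ t ∈ Icc 0 T, |f n t| ≤ C) →
      ∃ F : ℝ → ℝ, ∀ t ∈ Icc 0 T, Tendsto (fun n => f n t) (hyperfilter ℕ : Filter ℕ) (𝓝 (F t)) := by
    intro f C hf
    have : ∀ t, ∃ l, t ∈ Icc 0 T → Tendsto (fun n => f n t) (hyperfilter ℕ : Filter ℕ) (𝓝 l) := by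
      intro t
      by_cases ht : t ∈ Icc 0 T
      · obtain ⟨l, -, hl⟩ := (isCompact_Icc (a := -C) (b := C)).ultrafilter_le_nhds
          ((hyperfilter ℕ).map fun n => f n t)
          (le_principal_iff.2 (mem_map.2 (univ_mem' fun n => abs_le.1 (hf n t ht))))
        exact ⟨l, fun _ => hl⟩
      · exact ⟨0, fun hh => absurd hh ht⟩
    choose F hF using this
    exact ⟨F, hF⟩
  set B := |b| + (1 + ε) * T with hB
  have hyB : ∀ n, ∀ t ∈ Icc 0 T, |y n t| ≤ B := fun n t ht => by
    have := (h n).abs_velocity_le hε ht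
    rwa [hy0 n] at this
  have hB0 : 0 ≤ B := (abs_nonneg _).trans (hyB 0 0 h0)
  have hxL : ∀ n, ∀ s ∈ Icc 0 T, ∀ t ∈ Icc 0 T, |x n t - x n s| ≤ B * |t - s| :=
    fun n s hs t ht => abs_sub_le_of_hasDerivWithinAt (h n).hasDeriv_angle (hyB n) hs ht
  have hxB : ∀ n, ∀ t ∈ Icc 0 T, |x n t| ≤ |a| + B * T := fun n t ht => by
    have h1 := hxL n 0 h0 t ht
    have h2 := abs_sub_abs_le_abs_sub (x n t) (x n 0)
    rw [sub_zero, abs_of_nonneg ht.1] at h1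
    rw [hx0 n] at *
    have := mul_le_mul_of_nonneg_left ht.2 hB0
    linarith
  have hWB : ∀ n, ∀ t ∈ Icc 0 T, |W n t| ≤ ε * T := fun n t ht => by
    have h1 := (h n).abs_control_le 0 h0 t ht ht.1
    rw [hW0 n, sub_zero, sub_zero] at h1
    exact h1.trans (mul_le_mul_of_nonneg_left ht.2 hε)
  obtain ⟨X, hX⟩ := lim hxB
  obtain ⟨Y, hY⟩ := lim hyB
  obtain ⟨Z, hZ⟩ := lim hWB
  have hTm : T ∈ Icc 0 T := ⟨hT, le_rfl⟩
  refine ⟨X, Y, Z, ⟨fun s hs => ?_, fun s hs => ?_, fun s hs t ht hst => ?_⟩, ?_, ?_,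
    hX T hTm, hY T hTm⟩
  · refine hasDerivWithinAt_of_abs_le_sq (K := 1 + ε) fun t ht => ?_
    refine le_of_tendsto (((hX t ht).sub (hX s hs)).sub ((hY s hs).mul_const (t - s))).abs
      (Eventually.of_forall fun n => ?_)
    exact abs_sub_sub_mul_le_of_hasDerivWithinAt (by linarith) (h n).hasDeriv_angle
      (fun s hs t ht => (h n).abs_velocity_sub_le hs ht) hs ht
  · refine hasDerivWithinAt_of_abs_le_sq (K := B) fun t ht => ?_
    have hsin := (Real.continuous_sin.tendsto _).comp (hX s hs)
    refine le_of_tendsto (((((hY t ht).sub (hZ t ht)).sub ((hY s hs).sub (hZ s hs)))).sub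
      (hsin.neg.mul_const (t - s))).abs (Eventually.of_forall fun n => ?_)
    refine abs_sub_sub_mul_le_of_hasDerivWithinAt hB0 (h n).hasDeriv_velocity
      (fun s hs t ht => ?_) hs ht
    refine le_trans ?_ (hxL n s hs t ht)
    rw [neg_sub_neg, abs_sub_comm (x n t)]
    exact Real.abs_sin_sub_sin_le _ _
  · refine le_of_tendsto ((hZ t ht).sub (hZ s hs)).abs (Eventually.of_forall fun n => ?_)
    exact (h n).abs_control_le s hs t ht hst
  · refine tendsto_nhds_unique (hX 0 h0) ?_
    simp [hx0]
  · refine tendsto_nhds_unique (hY 0 h0) ?_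
    simp [hy0]

open Filter Topology in
lemma isLeast_csInf_damps {ε : ℝ} (hε : 0 ≤ ε) {p : ℝ × ℝ} (hne : {T | Damps ε T p}.Nonempty) :
    IsLeast {T | Damps ε T p} (sInf {T | Damps ε T p}) := by
  set S := {T | Damps ε T p} with hS
  have hbdd : BddBelow S := ⟨0, fun T hT => hT.nonneg⟩
  set m := sInf S with hm
  refine ⟨?_, fun T hT => csInf_le hbdd hT⟩
  have hm0 : 0 ≤ m := le_csInf hne fun T hT => hT.nonneg
  obtain ⟨τ, -, hτm, hτS⟩ := exists_seq_tendsto_sInf hne hbdd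
  have hmτ : ∀ n, m ≤ τ n := fun n => csInf_le hbdd (hτS n)
  choose k hτ0 x y W h hx0 hy0 hxT hyT using hτS
  obtain ⟨X, Y, Z, hXYZ, hX0, hY0, hXm, hYm⟩ := exists_tendsto_isLiftedPath hε hm0
    (fun n => (h n).mono (hmτ n)) hx0 hy0
  have hmem : ∀ n, m ∈ Icc 0 (τ n) := fun n => ⟨hm0, hmτ n⟩
  have hmem' : ∀ n, τ n ∈ Icc 0 (τ n) := fun n => ⟨hm0.trans (hmτ n), le_rfl⟩
  have hτ : Tendsto (fun n => |m - τ n|) (hyperfilter ℕ : Filter ℕ) (𝓝 0) := by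
    have : Tendsto (fun n => |m - τ n|) atTop (𝓝 |m - m|) := (hτm.const_sub m).abs
    simp only [sub_self, abs_zero] at this
    exact this.mono_left Nat.hyperfilter_le_atTop
  have hYz : Y m = 0 := by
    refine tendsto_nhds_unique hYm (squeeze_zero_norm (a := fun n => (1 + ε) * |m - τ n|)
      (fun n => ?_) (by simpa using hτ.const_mul (1 + ε)))
    have := (h n).abs_velocity_sub_le (hmem' n) (hmem n)
    rwa [hyT n, sub_zero] at this
  have hbound : ∀ᶠ n in (hyperfilter ℕ : Filter ℕ), τ n ≤ m + 1 :=
    (hτm.eventually_le_const (lt_add_one m)).filter_mono Nat.hyperfilter_le_atTop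
  have hXz : Real.cos (X m) = 1 := by
    have h1 : Tendsto (fun n => Real.cos (x n m)) (hyperfilter ℕ : Filter ℕ)
      (𝓝 (Real.cos (X m))) := (Real.continuous_cos.tendsto _).comp hXm
    refine tendsto_nhds_unique h1 ?_
    rw [tendsto_iff_norm_sub_tendsto_zero]
    refine squeeze_zero' (Eventually.of_forall fun n => norm_nonneg _)
      (g := fun n => (|p.2| + (1 + ε) * (m + 1)) * |m - τ n|) ?_ (by simpa using hτ.const_mul _)
    filter_upwards [hbound] with n hn
    have h2 : |x n m - x n (τ n)| ≤ (|p.2| + (1 + ε) * (m + 1)) * |m - τ n| := by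
      refine abs_sub_le_of_hasDerivWithinAt (h n).hasDeriv_angle (fun t ht => ?_) (hmem' n) (hmem n)
      have h3 := (h n).abs_velocity_le hε ht
      rw [hy0 n] at h3
      refine h3.trans (add_le_add_right (mul_le_mul_of_nonneg_left hn (by linarith)) _)
    refine le_trans ?_ h2
    have h4 : Real.cos (x n (τ n)) = 1 := by
      rw [hxT n]; exact Real.cos_int_mul_two_pi (k n)
    rw [← h4]
    exact Real.abs_cos_sub_cos_le _ _
  obtain ⟨j, hj⟩ := (Real.cos_eq_one_iff _).1 hXz
  exact ⟨j, hm0, X, Y, Z, hXYZ, hX0, hY0, hj.symm, hYz⟩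

/-- Global solvability of `x' = v + W t`, `v' = g (x, v)` for bounded locally Lipschitz `g`. -/
lemma exists_planar_solution {g : ℝ × ℝ → ℝ} (hg : LocallyLipschitz g) {B : ℝ}
    (hB : ∀ q, |g q| ≤ B) {W : ℝ → ℝ} (hW : Continuous W) {T : ℝ} (hT : 0 ≤ T) (p : ℝ × ℝ) :
    ∃ x v : ℝ → ℝ, x 0 = p.1 ∧ v 0 = p.2 ∧
      ∀ t ∈ Icc 0 T, HasDerivAt x (v t + W t) t ∧ HasDerivAt v (g (x t, v t)) t := by
  have hB0 : 0 ≤ B := (abs_nonneg _).trans (hB 0)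
  obtain ⟨C, hC⟩ := (isCompact_Icc (a := (-1 : ℝ)) (b := T + 1)).exists_bound_of_continuousOn
    hW.continuousOn
  have h0 : (0 : ℝ) ∈ Icc (-1) (T + 1) := ⟨by norm_num, by linarith⟩
  have hC0 : 0 ≤ C := (norm_nonneg _).trans (hC 0 h0)
  set M : ℝ := |p.2| + B * (T + 1) with hM
  have hM0 : 0 ≤ M := by positivity
  set G : ℝ × ℝ → ℝ × ℝ := fun q => (max (-M) (min M q.2), g q) with hG
  have hGL : LocallyLipschitz G :=
    ((LipschitzWith.prod_snd.locallyLipschitz.const_min M).const_max (-M)).prodMk hg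
  set L : ℝ := M + C + B with hL
  have hL0 : 0 ≤ L := by positivity
  obtain ⟨K, hK⟩ := (hGL.locallyLipschitzOn (s := Metric.closedBall p (L * (T + 1)))
    ).exists_lipschitzOnWith_of_compact (isCompact_closedBall _ _)
  have hclamp : ∀ r : ℝ, |max (-M) (min M r)| ≤ M := fun r =>
    abs_le.2 ⟨le_max_left _ _, max_le (by linarith) (min_le_left _ _)⟩
  have hPL : IsPicardLindelof (fun t q => G q + (W t, 0)) (⟨0, h0⟩ : Icc (-1 : ℝ) (T + 1)) p
      ⟨L * (T + 1), by positivity⟩ 0 ⟨L, hL0⟩ K := by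
    refine ⟨fun t _ => ?_, fun q _ => by fun_prop, fun t ht q _ => ?_, ?_⟩
    · refine LipschitzOnWith.of_dist_le_mul fun q hq r hr => ?_
      rw [dist_add_right]
      exact hK.dist_le_mul q hq r hr
    · rw [Prod.norm_def]
      refine max_le ?_ ?_
      · refine (norm_add_le _ _).trans ?_
        have h1 := hclamp q.2
        have h2 := hC t ht
        change |max (-M) (min M q.2)| + ‖W t‖ ≤ L
        linarith
      · change |g q + 0| ≤ L
        rw [add_zero]
        linarith [hB q]
    · change L * max (T + 1 - 0) (0 - -1) ≤ L * (T + 1) - 0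
      rw [max_eq_left (by linarith)]
      linarith
  obtain ⟨α, hα0, hα⟩ := hPL.exists_eq_forall_mem_Icc_hasDerivWithinAt₀
  have hder : ∀ t ∈ Icc 0 T, HasDerivAt α (G (α t) + (W t, 0)) t := fun t ht =>
    (hα t ⟨by linarith [ht.1], by linarith [ht.2]⟩).hasDerivAt
      (Icc_mem_nhds (by linarith [ht.1]) (by linarith [ht.2]))
  have hsnd : ∀ t ∈ Icc 0 T, HasDerivAt (fun t => (α t).2) (g (α t)) t := fun t ht => by
    have := (ContinuousLinearMap.snd ℝ ℝ ℝ).hasFDerivAt.comp_hasDerivAt t (hder t ht)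
    simp only [hG, map_add] at this
    simpa [Function.comp_def] using this
  have hα0' : α 0 = p := hα0
  refine ⟨fun t => (α t).1, fun t => (α t).2, by simp [hα0'], by simp [hα0'], fun t ht =>
    ⟨?_, hsnd t ht⟩⟩
  have h1 := (ContinuousLinearMap.fst ℝ ℝ ℝ).hasFDerivAt.comp_hasDerivAt t (hder t ht)
  have h2 : |(α t).2| ≤ M := by
    have h3 := abs_sub_le_of_hasDerivWithinAt (fun t ht => (hsnd t ht).hasDerivWithinAt)
      (fun t _ => hB (α t)) (⟨le_rfl, hT⟩ : (0 : ℝ) ∈ Icc 0 T) ht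
    have h4 := abs_sub_abs_le_abs_sub (α t).2 (α 0).2
    rw [sub_zero, abs_of_nonneg ht.1] at h3
    rw [hα0'] at h3 h4
    have := mul_le_mul_of_nonneg_left ht.2 hB0
    linarith
  have h3 : max (-M) (min M (α t).2) = (α t).2 := by
    rw [min_eq_right (abs_le.1 h2).2, max_eq_right (abs_le.1 h2).1]
  simpa [hG, h3, Function.comp_def] using h1

/-- Continuous dependence on the initial state, the control being kept. -/
lemma Steers.exists_dist_le {ε T : ℝ} {p q : ℝ × ℝ} (h : Steers ε T p q) (p' : ℝ × ℝ) :
    ∃ q', Steers ε T p' q' ∧ dist q' q ≤ dist p' p * Real.exp T := by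
  obtain ⟨hT, x, y, W, h, hx0, hy0, hxT, hyT⟩ := h
  set V : ℝ → ℝ := fun t => W (projIcc 0 T hT t) with hV
  have hVc : Continuous V :=
    (continuousOn_iff_continuous_domRestrict.1 h.continuousOn_control).comp continuous_projIcc
  have hVW : ∀ t ∈ Icc 0 T, V t = W t := fun t ht => by simp [hV, projIcc_of_mem hT ht]
  have h0 : (0 : ℝ) ∈ Icc 0 T := ⟨le_rfl, hT⟩
  have hTm : T ∈ Icc 0 T := ⟨hT, le_rfl⟩
  have hsin : LipschitzWith 1 fun q : ℝ × ℝ => -Real.sin q.1 := by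
    refine LipschitzWith.of_dist_le_mul fun q r => ?_
    rw [NNReal.coe_one, one_mul, dist_neg_neg]
    exact (Real.abs_sin_sub_sin_le _ _).trans (le_max_left _ _)
  obtain ⟨X, U, hX0, hU0, hXU⟩ := exists_planar_solution hsin.locallyLipschitz (B := 1)
    (fun q => by rw [abs_neg]; exact Real.abs_sin_le_one _) hVc hT (p'.1, p'.2 - W 0)
  refine ⟨(X T, U T + V T), ⟨hT, X, fun t => U t + V t, V, ⟨?_, ?_, ?_⟩, hX0, ?_, rfl, rfl⟩, ?_⟩
  · exact fun t ht => (hXU t ht).1.hasDerivWithinAt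
  · intro t ht
    simpa using (hXU t ht).2.hasDerivWithinAt
  · intro s hs t ht hst
    rw [hVW s hs, hVW t ht]
    exact h.abs_control_le s hs t ht hst
  · simp [hU0, hVW 0 h0]
  have ici : ∀ {f : ℝ → ℝ} {f' t : ℝ}, t ∈ Ico 0 T → HasDerivWithinAt f f' (Icc 0 T) t →
      HasDerivWithinAt f f' (Ici t) t := fun ht hf =>
    hf.mono_of_mem_nhdsWithin (Icc_mem_nhdsGE_of_mem ht)
  have key := dist_le_of_trajectories_ODE (K := 1) (a := 0) (b := T) (E := ℝ × ℝ)
    (v := fun t q => (q.2 + V t, -Real.sin q.1)) (f := fun t => (X t, U t))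
    (g := fun t => (x t, y t - W t)) (δ := dist p' p) ?_ ?_ ?_ ?_ ?_ ?_ T hTm
  · rw [sub_zero, NNReal.coe_one, one_mul, Prod.dist_eq] at key
    rw [Prod.dist_eq, ← hxT, ← hyT]
    refine max_le ((le_max_left _ _).trans key) (le_trans ?_ ((le_max_right _ _).trans key))
    simp only [hVW T hTm]
    rw [← dist_add_right _ (y T - W T) (W T), sub_add_cancel]
  · intro t
    have : LipschitzWith 1 fun q : ℝ × ℝ => q.2 + V t := by
      refine LipschitzWith.of_dist_le_mul fun q r => ?_
      rw [NNReal.coe_one, one_mul, dist_add_right]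
      exact le_max_right _ _
    simpa using this.prodMk hsin
  · exact fun t ht => ((hXU t ht).1.continuousAt.prodMk (hXU t ht).2.continuousAt).continuousWithinAt
  · exact fun t ht => ((hXU t ⟨ht.1, ht.2.le⟩).1.prodMk (hXU t ⟨ht.1, ht.2.le⟩).2).hasDerivWithinAt
  · exact h.continuousOn_angle.prodMk h.continuousOn_drift
  · intro t ht
    have ht' : t ∈ Icc 0 T := ⟨ht.1, ht.2.le⟩
    have := (ici ht (h.hasDeriv_angle t ht')).prodMk (ici ht (h.hasDeriv_velocity t ht'))
    simpa [hVW t ht'] using this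
  · rw [hX0, hU0, hx0, hy0, Prod.dist_eq, Prod.dist_eq, dist_sub_right]

lemma abs_sin_sub_le_cube (r : ℝ) : |Real.sin r - r| ≤ |r| ^ 3 := by
  have pos : ∀ r : ℝ, 0 < r → |Real.sin r - r| ≤ |r| ^ 3 := fun r hr => by
    have h1 := Real.sin_lt hr
    have h2 := Real.sin_gt_sub_cube hr
    have h3 := pow_pos hr 3
    rw [abs_of_pos hr, abs_le]
    constructor <;> linarith
  rcases lt_trichotomy r 0 with hr | rfl | hr
  · have := pos (-r) (neg_pos.2 hr)
    rwa [Real.sin_neg, abs_neg, ← abs_neg, show -(-Real.sin r - -r) = Real.sin r - r by ring] at this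
  · simp
  · exact pos r hr

/-- Explicit steering to the origin: the free harmonic motion times a cubic cut-off. -/
lemma steers_zero_of_le {ε τ a b : ℝ} (hτ : 0 < τ)
    (h : 6 * (|a| + |b|) / τ ^ 2 + 3 * (|a| + |b|) / τ + (|a| + |b|) ^ 3 ≤ ε) :
    Steers ε τ (a, b) (0, 0) := by
  set ρ := |a| + |b| with hρ
  have hρ0 : 0 ≤ ρ := by positivity
  set f : ℝ → ℝ := fun t => a * Real.cos t + b * Real.sin t with hf
  set f' : ℝ → ℝ := fun t => b * Real.cos t - a * Real.sin t with hf'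
  have hfd : ∀ t, HasDerivAt f (f' t) t := fun t => by
    have := ((Real.hasDerivAt_cos t).const_mul a).add ((Real.hasDerivAt_sin t).const_mul b)
    refine this.congr_deriv ?_
    simp only [hf']; ring
  have hfd' : ∀ t, HasDerivAt f' (-f t) t := fun t => by
    have := ((Real.hasDerivAt_cos t).const_mul b).sub ((Real.hasDerivAt_sin t).const_mul a)
    refine this.congr_deriv ?_
    simp only [hf]; ring
  have comb : ∀ c d u v : ℝ, |u| ≤ 1 → |v| ≤ 1 → |c * u + d * v| ≤ |c| + |d| := by
    intro c d u v hu hv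
    refine (abs_add_le _ _).trans ?_
    rw [abs_mul, abs_mul]
    exact add_le_add (mul_le_of_le_one_right (abs_nonneg _) hu)
      (mul_le_of_le_one_right (abs_nonneg _) hv)
  have hfb : ∀ t, |f t| ≤ ρ := fun t =>
    comb a b _ _ (Real.abs_cos_le_one t) (Real.abs_sin_le_one t)
  have hfb' : ∀ t, |f' t| ≤ ρ := fun t => by
    have := comb b (-a) _ _ (Real.abs_cos_le_one t) (Real.abs_sin_le_one t)
    rw [abs_neg, add_comm |b|] at this
    simpa [hf', sub_eq_add_neg] using this
  set φ : ℝ → ℝ := fun t => 1 - 3 * (t / τ) ^ 2 + 2 * (t / τ) ^ 3 with hφ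
  set φ' : ℝ → ℝ := fun t => (-6 * (t / τ) + 6 * (t / τ) ^ 2) / τ with hφ'
  set φ'' : ℝ → ℝ := fun t => (-6 + 12 * (t / τ)) / τ ^ 2 with hφ''
  have hid : ∀ t : ℝ, HasDerivAt (fun t => t / τ) (1 / τ) t := fun t =>
    (hasDerivAt_id t).div_const τ
  have hφd : ∀ t, HasDerivAt φ (φ' t) t := fun t => by
    have := ((((hid t).pow 2).const_mul 3).const_sub 1).add (((hid t).pow 3).const_mul 2)
    refine this.congr_deriv ?_
    simp only [hφ']; push_cast; field_simp; ring
  have hφd' : ∀ t, HasDerivAt φ' (φ'' t) t := fun t => by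
    have := (((hid t).const_mul (-6)).add (((hid t).pow 2).const_mul 6)).div_const τ
    refine this.congr_deriv ?_
    simp only [hφ'']; push_cast; field_simp; ring
  have hs : ∀ t ∈ Icc 0 τ, 0 ≤ t / τ ∧ t / τ ≤ 1 := fun t ht =>
    ⟨div_nonneg ht.1 hτ.le, (div_le_one hτ).2 ht.2⟩
  have hφb : ∀ t ∈ Icc 0 τ, |φ t| ≤ 1 := fun t ht => by
    obtain ⟨h0, h1⟩ := hs t ht
    simp only [hφ]
    rw [abs_le]
    constructor <;> nlinarith [mul_nonneg (sq_nonneg (t / τ)) (sub_nonneg.2 h1),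
      mul_nonneg h0 (sub_nonneg.2 h1), sq_nonneg (t / τ)]
  have hφb' : ∀ t ∈ Icc 0 τ, |φ' t| ≤ (3 / 2) / τ := fun t ht => by
    obtain ⟨h0, h1⟩ := hs t ht
    simp only [hφ']
    rw [abs_div, abs_of_pos hτ]
    refine div_le_div_of_nonneg_right ?_ hτ.le
    rw [abs_le]
    constructor <;> nlinarith [sq_nonneg (t / τ - 1 / 2), mul_nonneg h0 (sub_nonneg.2 h1)]
  have hφb'' : ∀ t ∈ Icc 0 τ, |φ'' t| ≤ 6 / τ ^ 2 := fun t ht => by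
    obtain ⟨h0, h1⟩ := hs t ht
    simp only [hφ'']
    rw [abs_div, abs_of_pos (pow_pos hτ 2)]
    refine div_le_div_of_nonneg_right ?_ (pow_pos hτ 2).le
    rw [abs_le]
    constructor <;> linarith
  have hxd : ∀ t, HasDerivAt (fun t => φ t * f t) (φ' t * f t + φ t * f' t) t := fun t =>
    (hφd t).mul (hfd t)
  have hyd : ∀ t, HasDerivAt (fun t => φ' t * f t + φ t * f' t)
      (φ'' t * f t + φ' t * f' t + (φ' t * f' t + φ t * -f t)) t := fun t =>
    ((hφd' t).mul (hfd t)).add ((hφd t).mul (hfd' t))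
  obtain ⟨W, hW⟩ := IsLiftedPath.of_hasDerivWithinAt (ε := ε) (T := τ)
    (fun t _ => (hxd t).hasDerivWithinAt) (fun t _ => (hyd t).hasDerivWithinAt) (by
      intro t ht
      have e1 : |φ'' t * f t| ≤ 6 / τ ^ 2 * ρ := by
        rw [abs_mul]
        exact mul_le_mul (hφb'' t ht) (hfb t) (abs_nonneg _) (by positivity)
      have e2 : |φ' t * f' t| ≤ (3 / 2) / τ * ρ := by
        rw [abs_mul]
        exact mul_le_mul (hφb' t ht) (hfb' t) (abs_nonneg _) (by positivity)
      have e3 : |φ t * f t| ≤ ρ := by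
        rw [abs_mul]
        exact (mul_le_of_le_one_left (abs_nonneg _) (hφb t ht)).trans (hfb t)
      have e4 : |Real.sin (φ t * f t) - φ t * f t| ≤ ρ ^ 3 := by
        have := abs_sin_sub_le_cube (φ t * f t)
        exact this.trans (pow_le_pow_left₀ (abs_nonneg _) e3 3)
      have e5 : φ'' t * f t + φ' t * f' t + (φ' t * f' t + φ t * -f t) + Real.sin (φ t * f t)
          = φ'' t * f t + φ' t * f' t + φ' t * f' t + (Real.sin (φ t * f t) - φ t * f t) := by ring
      have e6 : 6 / τ ^ 2 * ρ + (3 / 2) / τ * ρ + (3 / 2) / τ * ρ + ρ ^ 3 ≤ ε := by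
        refine le_trans (le_of_eq ?_) h
        field_simp; ring
      rw [e5]
      have a1 := abs_add_le (φ'' t * f t + φ' t * f' t + φ' t * f' t)
        (Real.sin (φ t * f t) - φ t * f t)
      have a2 := abs_add_le (φ'' t * f t + φ' t * f' t) (φ' t * f' t)
      have a3 := abs_add_le (φ'' t * f t) (φ' t * f' t)
      linarith)
  have hone : τ / τ = 1 := div_self hτ.ne'
  have c1 : φ τ = 0 := by simp only [hφ, hone]; norm_num
  have c2 : φ' τ = 0 := by simp only [hφ', hone]; norm_num
  have c3 : φ 0 = 1 := by simp [hφ]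
  have c4 : φ' 0 = 0 := by simp [hφ']
  exact ⟨hτ.le, _, _, W, hW, by simp [c3, hf], by simp [c3, c4, hf'], by simp [c1],
    by simp [c1, c2]⟩

/-- The energy of the uncontrolled pendulum. -/
noncomputable def energy (x y : ℝ) : ℝ := y ^ 2 / 2 + (1 - Real.cos x)

lemma energy_nonneg (x y : ℝ) : 0 ≤ energy x y := by
  have := Real.cos_le_one x
  unfold energy
  nlinarith [sq_nonneg y]

open Filter Topology in
lemma Damps.eventually {ε T τ : ℝ} {p : ℝ × ℝ} (hε : 0 < ε) (hτ : 0 < τ) (h : Damps ε T p) :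
    ∀ᶠ p' in 𝓝 p, Damps ε (T + τ) p' := by
  obtain ⟨k, hk⟩ := h
  set c : ℝ := k * (2 * Real.pi) with hc
  set g : ℝ → ℝ := fun d => 6 * (d + d) / τ ^ 2 + 3 * (d + d) / τ + (d + d) ^ 3 with hg
  have h1 : Tendsto (fun p' => g (dist p' p * Real.exp T)) (𝓝 p) (𝓝 0) := by
    have : Continuous (fun p' => g (dist p' p * Real.exp T)) := by
      simp only [hg]; fun_prop
    simpa [hg] using this.tendsto p
  filter_upwards [h1.eventually_lt_const hε] with p' hp'
  obtain ⟨q, hq, hd⟩ := hk.exists_dist_le p'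
  refine Damps.of_steers hq ⟨k, ?_⟩
  set d := dist p' p * Real.exp T
  have e1 : |q.1 - c| ≤ d := (le_max_left _ _).trans hd
  have e2 : |q.2| ≤ d := by
    have := (le_max_right _ _).trans hd
    rwa [Real.dist_eq, sub_zero] at this
  have hd0 : 0 ≤ d := (abs_nonneg _).trans e2
  have hsum : |q.1 - c| + |q.2| ≤ d + d := add_le_add e1 e2
  have key := steers_zero_of_le (ε := ε) (a := q.1 - c) (b := q.2) hτ (by
    refine le_trans ?_ hp'.le
    simp only [hg]
    gcongr)
  simpa [hc] using key.add_const (c := c) (fun r => sin_add_int_mul_two_pi_eq k r)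

lemma abs_sub_le_of_abs_sub_le_add_sq {f : ℝ → ℝ} {a b c L : ℝ} (hab : a ≤ b)
    (h : ∀ s ∈ Icc a b, ∀ t ∈ Icc a b, s ≤ t → |f t - f s| ≤ c * (t - s) + L * (t - s) ^ 2) :
    |f b - f a| ≤ c * (b - a) := by
  have key : ∀ n : ℕ, |f b - f a| ≤ c * (b - a) + L * (b - a) ^ 2 * (1 / ((n : ℝ) + 1)) := by
    intro n
    have hn : (0 : ℝ) < (n : ℝ) + 1 := by positivity
    set δ : ℝ := (b - a) / (n + 1) with hδ
    have hδ0 : 0 ≤ δ := div_nonneg (sub_nonneg.2 hab) hn.le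
    have hδn : ((n : ℝ) + 1) * δ = b - a := by rw [hδ]; field_simp
    have htel : f b - f a = ∑ i ∈ Finset.range (n + 1), (f (a + (i + 1 : ℕ) * δ) - f (a + (i : ℕ) * δ)) := by
      rw [Finset.sum_range_sub (fun i : ℕ => f (a + i * δ))]
      push_cast
      rw [hδn]; simp
    rw [htel]
    refine (Finset.abs_sum_le_sum_abs _ _).trans ?_
    have hterm : ∀ i ∈ Finset.range (n + 1),
        |f (a + (i + 1 : ℕ) * δ) - f (a + (i : ℕ) * δ)| ≤ c * δ + L * δ ^ 2 := by
      intro i hi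
      have hi' : ((i : ℝ) + 1) ≤ n + 1 := by
        exact_mod_cast Finset.mem_range.1 hi
      have hi0 : (0 : ℝ) ≤ i := Nat.cast_nonneg i
      have m1 : ((i : ℝ) + 1) * δ ≤ b - a := by
        rw [← hδn]; exact mul_le_mul_of_nonneg_right hi' hδ0
      have m2 : 0 ≤ (i : ℝ) * δ := mul_nonneg hi0 hδ0
      have := h (a + (i : ℕ) * δ) ⟨by linarith, by linarith⟩ (a + (i + 1 : ℕ) * δ)
        ⟨by push_cast; linarith, by push_cast; linarith⟩ (by push_cast; linarith)
      refine this.trans (le_of_eq ?_)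
      push_cast; ring
    refine (Finset.sum_le_sum hterm).trans (le_of_eq ?_)
    rw [Finset.sum_const, Finset.card_range, nsmul_eq_mul]
    push_cast
    rw [hδ]; field_simp
  have hlim := (tendsto_one_div_add_atTop_nhds_zero_nat (𝕜 := ℝ)).const_mul (L * (b - a) ^ 2)
  have := ge_of_tendsto' (hlim.const_add (c * (b - a))) key
  simpa using this

lemma IsLiftedPath.abs_energy_sub_le {ε T B : ℝ} {x y W : ℝ → ℝ} (hε : 0 ≤ ε)
    (h : IsLiftedPath ε T x y W) (hB : ∀ t ∈ Icc 0 T, |y t| ≤ B) {s t : ℝ}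
    (hs : s ∈ Icc 0 T) (ht : t ∈ Icc 0 T) (hst : s ≤ t) :
    |energy (x t) (y t) - energy (x s) (y s)| ≤ ε * B * (t - s) := by
  have hss : Icc s t ⊆ Icc 0 T := Icc_subset_Icc hs.1 ht.2
  refine abs_sub_le_of_abs_sub_le_add_sq (f := fun r => energy (x r) (y r)) (L := ε ^ 2 + ε) hst
    fun a ha b hb hab => ?_
  have ha' := hss ha
  have hb' := hss hb
  have hab' : Icc a b ⊆ Icc 0 T := Icc_subset_Icc ha'.1 hb'.2
  have hΔ := h.abs_control_le a ha' b hb' hab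
  set G : ℝ → ℝ := fun r => (y r - W r + W a) ^ 2 / 2 + (1 - Real.cos (x r)) with hG
  have hGd : ∀ r ∈ Icc a b, HasDerivWithinAt G (Real.sin (x r) * (W r - W a)) (Icc a b) r := by
    intro r hr
    have h1 := ((h.hasDeriv_velocity r (hab' hr)).mono hab').add_const (W a)
    have h2 := ((h.hasDeriv_angle r (hab' hr)).mono hab').cos
    refine (((h1.pow 2).div_const 2).add (h2.const_sub 1)).congr_deriv ?_
    simp only [Nat.cast_ofNat, Nat.add_one_sub_one, pow_one]
    ring
  have hGb : |G b - G a| ≤ ε * (b - a) * (b - a) := by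
    have := (convex_Icc a b).norm_image_sub_le_of_norm_hasDerivWithin_le hGd
      (C := ε * (b - a)) (fun r hr => ?_) (left_mem_Icc.2 hab) (right_mem_Icc.2 hab)
    · simpa [Real.norm_eq_abs, abs_of_nonneg (sub_nonneg.2 hab)] using this
    · rw [norm_mul]
      refine (mul_le_of_le_one_left (norm_nonneg _) (Real.abs_sin_le_one _)).trans ?_
      refine (h.abs_control_le a ha' r (hab' hr) hr.1).trans ?_
      exact mul_le_mul_of_nonneg_left (by linarith [hr.2]) hε
  have hdiff : energy (x b) (y b) - energy (x a) (y a)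
      = (G b - G a) + ((W b - W a) * y b - (W b - W a) ^ 2 / 2) := by
    simp only [hG, energy]; ring
  rw [hdiff]
  have e1 : |(W b - W a) * y b| ≤ ε * (b - a) * B := by
    rw [abs_mul]
    exact mul_le_mul hΔ (hB b hb') (abs_nonneg _) (mul_nonneg hε (sub_nonneg.2 hab))
  have e2 : |(W b - W a) ^ 2 / 2| ≤ (ε * (b - a)) ^ 2 := by
    rw [abs_of_nonneg (by positivity)]
    have := pow_le_pow_left₀ (abs_nonneg _) hΔ 2
    rw [sq_abs] at this
    linarith [sq_nonneg (W b - W a)]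
  have a1 := abs_add_le (G b - G a) ((W b - W a) * y b - (W b - W a) ^ 2 / 2)
  have a2 := abs_sub ((W b - W a) * y b) ((W b - W a) ^ 2 / 2)
  nlinarith [a1, a2, e1, e2, hGb]

/-- Damping the energy `E` takes a time of at least `√(E / 2) / ε`. -/
lemma Damps.energy_le {ε T : ℝ} {p : ℝ × ℝ} (hε : 0 ≤ ε) (h : Damps ε T p) :
    energy p.1 p.2 ≤ 2 * (ε * T) ^ 2 := by
  obtain ⟨k, hT, x, y, W, h, hx0, hy0, hxT, hyT⟩ := h
  obtain ⟨m, hm, hmax⟩ := isCompact_Icc.exists_isMaxOn (nonempty_Icc.2 hT)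
    (h.continuousOn_velocity.abs)
  set B := |y m| with hB
  have hyB : ∀ t ∈ Icc 0 T, |y t| ≤ B := fun t ht => hmax ht
  have hT' : T ∈ Icc 0 T := ⟨hT, le_rfl⟩
  have hET : energy (x T) (y T) = 0 := by
    have : Real.cos (x T) = 1 := by rw [hxT]; exact Real.cos_int_mul_two_pi k
    simp [energy, hyT, this]
  have key : ∀ t ∈ Icc 0 T, energy (x t) (y t) ≤ ε * B * T := fun t ht => by
    have := h.abs_energy_sub_le hε hyB ht hT' ht.2
    rw [hET, zero_sub, abs_neg] at this
    refine (le_abs_self _).trans (this.trans (mul_le_mul_of_nonneg_left (by linarith [ht.1]) ?_))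
    exact mul_nonneg hε (abs_nonneg _)
  have hB0 : 0 ≤ B := abs_nonneg _
  have hεT : 0 ≤ ε * T := mul_nonneg hε hT
  have h1 : B ^ 2 / 2 ≤ ε * B * T := by
    refine le_trans ?_ (key m hm)
    rw [hB, sq_abs]
    unfold energy
    linarith [Real.cos_le_one (x m)]
  have h2 : B ≤ 2 * (ε * T) := by
    rcases hB0.eq_or_lt with hz | hpos
    · rw [← hz]; positivity
    · nlinarith
  have h3 := key 0 ⟨le_rfl, hT⟩
  rw [hx0, hy0] at h3
  nlinarith

/-- The trajectories generated by a bounded locally Lipschitz feedback control. -/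
lemma exists_feedback_path {ε T : ℝ} (hε : 0 ≤ ε) (hT : 0 ≤ T) {u : ℝ × ℝ → ℝ}
    (hu : LocallyLipschitz u) (hu1 : ∀ q, |u q| ≤ 1) (a b : ℝ) :
    ∃ x y : ℝ → ℝ, x 0 = a ∧ y 0 = b ∧ (∀ t ∈ Icc 0 T, HasDerivAt x (y t) t) ∧
      (∀ t ∈ Icc 0 T, HasDerivAt y (-Real.sin (x t) + ε * u (x t, y t)) t) ∧
      ∀ t ∈ Icc 0 T, Steers ε t (a, b) (x t, y t) := by
  have hL : LocallyLipschitz fun q : ℝ × ℝ => -Real.sin q.1 + ε * u q := by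
    have h1 : LocallyLipschitz fun r : ℝ × ℝ => -Real.sin r.1 + ε * r.2 := by
      refine ContDiff.locallyLipschitz (𝕂 := ℝ) ?_
      fun_prop
    exact h1.comp (LipschitzWith.prod_fst.locallyLipschitz.prodMk hu)
  obtain ⟨x, y, hx0, hy0, hxy⟩ := exists_planar_solution hL (B := 1 + ε) (fun q => by
    refine (abs_add_le _ _).trans ?_
    rw [abs_neg, abs_mul, abs_of_nonneg hε]
    exact add_le_add (Real.abs_sin_le_one _) (mul_le_of_le_one_right hε (hu1 q)))
    (W := fun _ => 0) continuous_const hT (a, b)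
  refine ⟨x, y, hx0, hy0, fun t ht => by simpa using (hxy t ht).1, fun t ht => (hxy t ht).2,
    fun t ht => ?_⟩
  have hsub : Icc 0 t ⊆ Icc 0 T := Icc_subset_Icc_right ht.2
  obtain ⟨W, hW⟩ := IsLiftedPath.of_hasDerivWithinAt (ε := ε) (T := t)
    (x := x) (y := y) (fun s hs => by simpa using (hxy s (hsub hs)).1.hasDerivWithinAt)
    (fun s hs => (hxy s (hsub hs)).2.hasDerivWithinAt) (fun s _ => by
      rw [show -Real.sin (x s) + ε * u (x s, y s) + Real.sin (x s) = ε * u (x s, y s) by ring,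
        abs_mul, abs_of_nonneg hε]
      exact mul_le_of_le_one_right hε (hu1 _))
  exact ⟨ht.1, x, y, W, hW, hx0, hy0, rfl, rfl⟩

lemma sub_le_of_hasDerivAt_le {T c : ℝ} {f f' : ℝ → ℝ} (hT : 0 ≤ T)
    (hf : ∀ t ∈ Icc 0 T, HasDerivAt f (f' t) t) (hc : ∀ t ∈ Icc 0 T, f' t ≤ c) :
    f T ≤ f 0 + c * T := by
  have h := image_le_of_deriv_right_le_deriv_boundary (f := f) (f' := f') (a := 0) (b := T)
    (B := fun t => f 0 + c * t) (B' := fun _ => c)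
    (fun t ht => (hf t ht).continuousAt.continuousWithinAt)
    (fun t ht => (hf t ⟨ht.1, ht.2.le⟩).hasDerivWithinAt) (by simp) (by fun_prop)
    (fun t _ => by simpa using (((hasDerivAt_id t).const_mul c).const_add (f 0)).hasDerivWithinAt)
    (fun t ht => hc t ⟨ht.1, ht.2.le⟩)
  exact h ⟨hT, le_rfl⟩

/-- A continuous function that is positive at `0` and cannot vanish for the first time stays
positive. -/
lemma pos_of_forall_ne_zero {T : ℝ} {f : ℝ → ℝ} (hf : ContinuousOn f (Icc 0 T)) (h0 : 0 < f 0)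
    (h : ∀ t ∈ Icc 0 T, (∀ s ∈ Icc 0 t, 0 ≤ f s) → f t ≠ 0) : ∀ t ∈ Icc 0 T, 0 < f t := by
  by_contra! hcon
  obtain ⟨t₁, ht₁, hft₁⟩ := hcon
  have hfc : ContinuousOn f (Icc 0 t₁) := hf.mono (Icc_subset_Icc_right ht₁.2)
  have hZ : IsCompact (Icc 0 t₁ ∩ f ⁻¹' Iic 0) :=
    isCompact_Icc.of_isClosed_subset (hfc.preimage_isClosed_of_isClosed isClosed_Icc isClosed_Iic)
      inter_subset_left
  obtain ⟨m, ⟨hm, hfm⟩, hmin⟩ := hZ.exists_isLeast ⟨t₁, ⟨ht₁.1, le_rfl⟩, hft₁⟩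
  have hnn : ∀ s ∈ Icc 0 m, s < m → 0 < f s := fun s hs hsm => by
    by_contra! hc
    exact hsm.not_ge (hmin ⟨⟨hs.1, hs.2.trans hm.2⟩, hc⟩)
  have hm0 : 0 < m := by
    rcases hm.1.eq_or_lt with hz | hz
    · rw [← hz] at hfm; exact absurd hfm (not_le.2 h0)
    · exact hz
  have hfm0 : f m = 0 := by
    obtain ⟨c, hc, hfc0⟩ := intermediate_value_Icc' hm.1
      (hfc.mono (Icc_subset_Icc_right hm.2)) (⟨hfm, h0.le⟩ : (0 : ℝ) ∈ Icc (f m) (f 0))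
    rcases hc.2.eq_or_lt with rfl | hlt
    · exact hfc0
    · exact absurd hfc0 (hnn c hc hlt).ne'
  refine h m ⟨hm.1, hm.2.trans ht₁.2⟩ (fun s hs => ?_) hfm0
  rcases hs.2.eq_or_lt with rfl | hlt
  · exact hfm0.ge
  · exact (hnn s hs hlt).le

lemma hasDerivAt_energy {x y : ℝ → ℝ} {c t : ℝ} (hx : HasDerivAt x (y t) t)
    (hy : HasDerivAt y (-Real.sin (x t) + c) t) :
    HasDerivAt (fun t => energy (x t) (y t)) (c * y t) t := by
  refine (((hy.pow 2).div_const 2).add (hx.cos.const_sub 1)).congr_deriv ?_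
  simp only [Nat.cast_ofNat, Nat.add_one_sub_one, pow_one]
  ring

lemma abs_lt_pi_of_cos_ne {T : ℝ} {x : ℝ → ℝ} (hx : ContinuousOn x (Icc 0 T))
    (h0 : |x 0| < Real.pi) (h : ∀ t ∈ Icc 0 T, Real.cos (x t) ≠ -1) :
    ∀ t ∈ Icc 0 T, |x t| < Real.pi := by
  intro t ht
  refine sub_pos.1 (pos_of_forall_ne_zero (f := fun t => Real.pi - |x t|)
    (continuousOn_const.sub hx.abs) (sub_pos.2 h0) (fun s hs _ hz => h s hs ?_) t ht)
  rw [← Real.cos_abs, ← sub_eq_zero.1 hz, Real.cos_pi]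

lemma mul_sin_nonneg {r : ℝ} (hr : |r| ≤ Real.pi) : 0 ≤ r * Real.sin r := by
  rcases le_total 0 r with h | h
  · exact mul_nonneg h (Real.sin_nonneg_of_nonneg_of_le_pi h (le_of_abs_le hr))
  · exact mul_nonneg_of_nonpos_of_nonpos h
      (Real.sin_nonpos_of_nonpos_of_neg_pi_le h (abs_le.1 hr).1)

lemma sin_sq_le_mul_sin {r : ℝ} (hr : |r| ≤ Real.pi) : Real.sin r ^ 2 ≤ r * Real.sin r := by
  rw [← abs_of_nonneg (mul_sin_nonneg hr), abs_mul, ← sq_abs, sq]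
  exact mul_le_mul_of_nonneg_right Real.abs_sin_le_abs (abs_nonneg _)

lemma one_sub_cos_le_mul_sin {r : ℝ} (hr : |r| ≤ Real.pi) (hc : 0 ≤ Real.cos r) :
    1 - Real.cos r ≤ r * Real.sin r := by
  refine le_trans ?_ (sin_sq_le_mul_sin hr)
  rw [Real.sin_sq]
  nlinarith [Real.cos_le_one r]

lemma Damps.of_small {ε a b : ℝ} (hε : 0 < ε) (hε₁ : ε ≤ 1 / 10000) (ha : |a| ≤ 96 * ε)
    (hb : |b| ≤ 48 * ε) : Damps ε 1000 (a, b) := by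
  refine ⟨0, ?_⟩
  have h0 : 0 ≤ |a| + |b| := by positivity
  have h1 : |a| + |b| ≤ 144 * ε := by linarith
  have := steers_zero_of_le (ε := ε) (τ := 1000) (a := a) (b := b) (by norm_num) (by
    have h2 : (|a| + |b|) ^ 3 ≤ (144 * ε) ^ 3 := pow_le_pow_left₀ h0 h1 3
    have h3 : ε ^ 2 ≤ (1 / 10000) ^ 2 := pow_le_pow_left₀ hε.le hε₁ 2
    have h4 : (144 * ε) ^ 3 ≤ ε * (144 ^ 3 * (1 / 10000) ^ 2) := by nlinarith
    norm_num at h4 ⊢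
    linarith)
  simpa using this

lemma lyapunov_deriv_le {x y s R ε : ℝ} (hε : 0 < ε) (hR : 48 * ε ≤ R) (hx : |x| ≤ 2 * R)
    (hy : |y| ≤ R) (hD : R ^ 2 / 4 ≤ y ^ 2 + x * s) :
    -(ε * y ^ 2 / R ^ 2) + ε / 2 * (((y * y + x * (-s + ε * (-y / R))) * R ^ 2
      - x * y * (2 * R * -(ε * y ^ 2 / R ^ 2))) / (R ^ 2) ^ 2) ≤ -(ε / 16) := by
  have hR0 : 0 < R := by linarith
  set p := x / R with hp
  set q := y / R with hq
  have hp2 : |p| ≤ 2 := by rw [hp, abs_div, abs_of_pos hR0, div_le_iff₀ hR0]; exact hx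
  have hq1 : |q| ≤ 1 := by rw [hq, abs_div, abs_of_pos hR0, div_le_iff₀ hR0, one_mul]; exact hy
  have e : -(ε * y ^ 2 / R ^ 2) + ε / 2 * (((y * y + x * (-s + ε * (-y / R))) * R ^ 2
      - x * y * (2 * R * -(ε * y ^ 2 / R ^ 2))) / (R ^ 2) ^ 2)
      = -(ε / 2 * ((y ^ 2 + x * s) / R ^ 2)) + ε * (ε / R) / 2 * (p * q * (2 * q ^ 2 - 1)) := by
    rw [hp, hq]; field_simp; ring
  have h1 : 1 / 4 ≤ (y ^ 2 + x * s) / R ^ 2 := by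
    rw [le_div_iff₀ (by positivity)]; linarith
  have h2 : ε / R ≤ 1 / 48 := by rw [div_le_iff₀ hR0]; linarith
  have h3 : p * q * (2 * q ^ 2 - 1) ≤ 6 := by
    have hq2 : q ^ 2 ≤ 1 := by rw [← sq_abs]; exact pow_le_one₀ (abs_nonneg _) hq1
    have a1 : |2 * q ^ 2 - 1| ≤ 1 := by
      rw [abs_le]; constructor <;> nlinarith [sq_nonneg q]
    have a2 : |p * q * (2 * q ^ 2 - 1)| ≤ 2 * 1 * 1 := by
      rw [abs_mul, abs_mul]
      gcongr
    linarith [le_abs_self (p * q * (2 * q ^ 2 - 1))]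
  have h4 : ε * (ε / R) / 2 * (p * q * (2 * q ^ 2 - 1)) ≤ ε / 16 := by
    have : 0 ≤ ε * (ε / R) / 2 := by positivity
    have := mul_le_mul_of_nonneg_left h3 this
    nlinarith
  rw [e]
  nlinarith

/-- Damping of the small oscillations. -/
lemma Damps.of_energy_le_one {ε a b : ℝ} (hε : 0 < ε) (hε₁ : ε ≤ 1 / 10000) (ha : |a| < Real.pi)
    (hE : energy a b ≤ 1) : Damps ε (100 / ε) (a, b) := by
  set ψ : ℝ × ℝ → ℝ := fun q => Real.sqrt (2 * energy q.1 q.2 + ε ^ 2) with hψ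
  have hpos : ∀ q : ℝ × ℝ, 0 < 2 * energy q.1 q.2 + ε ^ 2 := fun q => by
    have := energy_nonneg q.1 q.2
    positivity
  have hψ0 : ∀ q, 0 < ψ q := fun q => Real.sqrt_pos.2 (hpos q)
  have hψsq : ∀ q, ψ q ^ 2 = 2 * energy q.1 q.2 + ε ^ 2 := fun q => Real.sq_sqrt (hpos q).le
  have hyψ : ∀ q : ℝ × ℝ, |q.2| ≤ ψ q := fun q => by
    refine abs_le_of_sq_le_sq ?_ (hψ0 q).le
    rw [hψsq]; unfold energy
    nlinarith [Real.cos_le_one q.1, sq_nonneg ε]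
  have hu : LocallyLipschitz fun q : ℝ × ℝ => -q.2 / ψ q := by
    refine ContDiff.locallyLipschitz (𝕂 := ℝ) ?_
    have h1 : ContDiff ℝ 1 fun q : ℝ × ℝ => 2 * energy q.1 q.2 + ε ^ 2 := by
      unfold energy; fun_prop
    exact contDiff_snd.neg.div (h1.sqrt fun q => (hpos q).ne') fun q => (hψ0 q).ne'
  have hu1 : ∀ q : ℝ × ℝ, |-q.2 / ψ q| ≤ 1 := fun q => by
    rw [abs_div, abs_neg, abs_of_pos (hψ0 q), div_le_one (hψ0 q)]
    exact hyψ q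
  have hT : 0 ≤ 64 / ε := by positivity
  obtain ⟨x, y, hx0, hy0, hx, hy, hst⟩ := exists_feedback_path hε.le hT hu hu1 a b
  set T := 64 / ε with hTdef
  set R : ℝ → ℝ := fun t => ψ (x t, y t) with hR
  have hR0 : ∀ t, 0 < R t := fun t => hψ0 _
  have hRsq : ∀ t, R t ^ 2 = 2 * energy (x t) (y t) + ε ^ 2 := fun t => hψsq _
  have hE' : ∀ t ∈ Icc 0 T,
      HasDerivAt (fun t => energy (x t) (y t)) (-(ε * y t ^ 2 / R t)) t := fun t ht => by
    refine (hasDerivAt_energy (hx t ht) (hy t ht)).congr_deriv ?_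
    simp only [hR]; ring
  have hE1 : ∀ t ∈ Icc 0 T, energy (x t) (y t) ≤ 1 := fun t ht => by
    have := sub_le_of_hasDerivAt_le (c := 0) ht.1 (fun s hs => hE' s ⟨hs.1, hs.2.trans ht.2⟩)
      (fun s _ => by
        have := hR0 s
        rw [neg_nonpos]; positivity)
    rw [hx0, hy0] at this
    linarith
  have hcos : ∀ t ∈ Icc 0 T, 0 ≤ Real.cos (x t) := fun t ht => by
    have := hE1 t ht
    unfold energy at this
    nlinarith [sq_nonneg (y t)]
  have hxpi : ∀ t ∈ Icc 0 T, |x t| < Real.pi := abs_lt_pi_of_cos_ne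
    (fun t ht => (hx t ht).continuousAt.continuousWithinAt) (by rwa [hx0])
    (fun t ht h => by linarith [hcos t ht])
  have hxR : ∀ t ∈ Icc 0 T, |x t| ≤ 2 * R t := fun t ht => by
    refine abs_le_of_sq_le_sq ?_ (by linarith [hR0 t])
    have h1 := Real.cos_le_one_sub_mul_cos_sq (hxpi t ht).le
    have h2 : 2 / 16 * x t ^ 2 ≤ 2 / Real.pi ^ 2 * x t ^ 2 := by
      gcongr
      nlinarith [Real.pi_pos, Real.pi_le_four]
    rw [mul_pow, hRsq]
    unfold energy
    nlinarith [sq_nonneg (y t), sq_nonneg ε]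
  have hyR : ∀ t, |y t| ≤ R t := fun t => hyψ (x t, y t)
  have hex : ∃ t ∈ Icc 0 T, R t < 48 * ε := by
    by_contra! hcon
    have hR' : ∀ t ∈ Icc 0 T, HasDerivAt R (-(ε * y t ^ 2 / R t ^ 2)) t := fun t ht => by
      refine ((((hE' t ht).const_mul 2).add_const (ε ^ 2)).sqrt (hpos (x t, y t)).ne').congr_deriv ?_
      change 2 * -(ε * y t ^ 2 / R t) / (2 * R t) = _
      have := (hR0 t).ne'
      field_simp
    have hV := sub_le_of_hasDerivAt_le (c := -(ε / 16)) hT (fun t ht =>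
      (hR' t ht).add ((((hx t ht).mul (hy t ht)).div ((hR' t ht).pow 2)
        (pow_pos (hR0 t) 2).ne').const_mul (ε / 2))) (fun t ht => by
        have h := lyapunov_deriv_le (s := Real.sin (x t)) hε (hcon t ht) (hxR t ht) (hyR t) (by
          have h1 := one_sub_cos_le_mul_sin (hxpi t ht).le (hcos t ht)
          have h2 := hRsq t
          have h3 := hcon t ht
          have h4 : (48 * ε) ^ 2 ≤ R t ^ 2 := pow_le_pow_left₀ (by positivity) h3 2
          unfold energy at h2
          nlinarith [sq_nonneg (y t)])
        refine le_trans (le_of_eq ?_) h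
        simp only [Nat.cast_ofNat, Nat.add_one_sub_one, pow_one, Pi.pow_apply, Pi.mul_apply]
        rfl)
    have hq : ∀ t ∈ Icc 0 T, |ε / 2 * (x t * y t / R t ^ 2)| ≤ ε := fun t ht => by
      have h1 : |x t * y t / R t ^ 2| ≤ 2 := by
        rw [abs_div, abs_mul, abs_of_pos (pow_pos (hR0 t) 2), div_le_iff₀ (pow_pos (hR0 t) 2)]
        have := mul_le_mul (hxR t ht) (hyR t) (abs_nonneg _) (by linarith [hR0 t])
        linarith
      rw [abs_mul, abs_of_pos (by positivity : 0 < ε / 2)]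
      nlinarith
    have h0m : (0 : ℝ) ∈ Icc 0 T := ⟨le_rfl, hT⟩
    have hTm : T ∈ Icc 0 T := ⟨hT, le_rfl⟩
    have q0 := (abs_le.1 (hq 0 h0m)).2
    have qT := (abs_le.1 (hq T hTm)).1
    have hεT : -(ε / 16) * T = -4 := by rw [hTdef]; field_simp; norm_num
    have hRT := hcon T hTm
    have hR00 : R 0 ≤ 2 := by
      refine abs_le_of_sq_le_sq' ?_ (by norm_num) |>.2
      rw [hRsq]
      nlinarith [hE1 0 h0m]
    simp only [Pi.add_apply, Pi.mul_apply, Pi.div_apply, Pi.pow_apply] at hV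
    linarith
  obtain ⟨t, ht, htR⟩ := hex
  have hfin := Damps.of_small hε hε₁ (a := x t) (b := y t) ((hxR t ht).trans (by linarith))
    ((hyR t).trans htR.le)
  refine (Damps.of_steers (hst t ht) hfin).mono hε.le ?_
  have : 1000 ≤ 36 / ε := by rw [le_div_iff₀ hε]; linarith
  have e : 100 / ε = T + 36 / ε := by rw [hTdef]; ring
  linarith [ht.2]

lemma sqrt_le_sq_add_mul_sin {x y η : ℝ} (hη : η = 2 - energy x y) (hη1 : η ≤ 1)
    (hx : |x| ≤ Real.pi) : Real.sqrt η ≤ y ^ 2 + x * Real.sin x := by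
  rcases le_or_gt 0 (Real.cos x) with hc | hc
  · have h1 := one_sub_cos_le_mul_sin hx hc
    have h2 : Real.sqrt η ≤ 1 := Real.sqrt_le_one.2 hη1
    unfold energy at hη
    nlinarith [sq_nonneg y]
  · have h1 : 1 ≤ |x| := by
      by_contra! hlt
      have := abs_lt.1 hlt
      exact hc.not_ge (Real.cos_nonneg_of_neg_pi_div_two_le_of_le
        (by linarith [Real.pi_gt_three]) (by linarith [Real.pi_gt_three]))
    have h2 : Real.sqrt η ≤ |Real.sin x| := by
      rw [← Real.sqrt_sq_eq_abs]
      refine Real.sqrt_le_sqrt ?_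
      rw [Real.sin_sq, hη]
      unfold energy
      nlinarith [Real.neg_one_le_cos x, sq_nonneg y]
    have h3 : x * Real.sin x = |x| * |Real.sin x| := by
      rw [← abs_mul, abs_of_nonneg (mul_sin_nonneg hx)]
    nlinarith [abs_nonneg (Real.sin x), sq_nonneg y]

lemma separatrix_lyapunov {ε x y η d F : ℝ} (hε : 0 < ε) (hε₁ : ε ≤ 1 / 10000) (hx : |x| ≤ 4)
    (hy : |y| ≤ 2) (hη0 : ε / 2 ≤ η) (hη1 : η ≤ 1) (hd : Real.sqrt η ≤ y ^ 2 + d)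
    (hF : F = η - ε / 16 * (x * y)) :
    0 ≤ ε * y ^ 2 / 2 - ε / 16 * (y ^ 2 - d - ε * (x * y) / 2) ∧ (ε / 3 ≤ F →
      ε * Real.sqrt F / 100 ≤ ε * y ^ 2 / 2 - ε / 16 * (y ^ 2 - d - ε * (x * y) / 2)) := by
  have hxy : |x * y| ≤ 4 * |y| := by
    rw [abs_mul]; exact mul_le_mul_of_nonneg_right hx (abs_nonneg _)
  obtain ⟨hxy1, hxy2⟩ := abs_le.1 hxy
  have hysq : |y| ^ 2 = y ^ 2 := sq_abs y
  have hy0 := abs_nonneg y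
  set w := |y| with hw
  have key : ε * (5 / 16 * y ^ 2 + Real.sqrt η / 16 - ε ^ 2 / 16)
      ≤ ε * y ^ 2 / 2 - ε / 16 * (y ^ 2 - d - ε * (x * y) / 2) := by
    have h1 : 0 ≤ y ^ 2 / 16 + ε ^ 2 / 16 + ε * (x * y) / 32 := by
      nlinarith [sq_nonneg (w - ε)]
    nlinarith
  have hηsq : Real.sqrt η ^ 2 = η := Real.sq_sqrt (by linarith)
  have hηs0 := Real.sqrt_nonneg η
  have hηle : η ≤ Real.sqrt η := by
    have : Real.sqrt η ≤ 1 := Real.sqrt_le_one.2 hη1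
    nlinarith
  have hε2 : ε ^ 2 ≤ ε / 10000 := by nlinarith
  refine ⟨le_trans (mul_nonneg hε.le ?_) key, fun hF3 => le_trans ?_ key⟩
  · nlinarith [sq_nonneg y]
  · have hFsq : Real.sqrt F ^ 2 = F := Real.sq_sqrt (by linarith)
    have hFs0 := Real.sqrt_nonneg F
    have hF2 : F ≤ 2 := by nlinarith
    have hFs2 : Real.sqrt F ≤ 3 / 2 := by
      rw [Real.sqrt_le_left (by norm_num)]; linarith
    rw [mul_div_assoc]
    refine mul_le_mul_of_nonneg_left ?_ hε.le
    rcases le_or_gt (1 / 3) w with hw3 | hw3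
    · have h1 : (1 / 3) ^ 2 ≤ w ^ 2 := pow_le_pow_left₀ (by norm_num) hw3 2
      linarith
    · have h1 : ε / 16 * -(x * y) ≤ ε / 16 * (4 / 3) :=
        mul_le_mul_of_nonneg_left (by linarith) (by linarith)
      have h2 : Real.sqrt F / 2 ≤ Real.sqrt η := by
        refine Real.le_sqrt_of_sq_le ?_
        rw [div_pow, hFsq]; linarith
      have h3 : ε / 6 ≤ Real.sqrt F := by
        refine Real.le_sqrt_of_sq_le ?_
        rw [div_pow]; linarith
      linarith [sq_nonneg y]

/-- Damping from an energy level below the separatrix by a margin of order `ε`. -/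
lemma Damps.of_energy_le_two_sub {ε a b : ℝ} (hε : 0 < ε) (hε₁ : ε ≤ 1 / 10000)
    (ha : |a| < Real.pi) (hE : energy a b ≤ 2 - Real.pi * ε / 4) : Damps ε (600 / ε) (a, b) := by
  set u : ℝ × ℝ → ℝ := fun q => max (-1) (min 1 (-q.2 / 2)) with hudef
  have hu : LocallyLipschitz u := by
    refine LocallyLipschitz.const_max (LocallyLipschitz.const_min ?_ _) _
    refine ContDiff.locallyLipschitz (𝕂 := ℝ) ?_
    fun_prop
  have hu1 : ∀ q, |u q| ≤ 1 := fun q =>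
    abs_le.2 ⟨le_max_left _ _, max_le (by norm_num) (min_le_left _ _)⟩
  have huy : ∀ q : ℝ × ℝ, u q * q.2 ≤ 0 := fun q => by
    rcases le_total 0 q.2 with h | h
    · exact mul_nonpos_of_nonpos_of_nonneg
        (max_le (by norm_num) ((min_le_right _ _).trans (by linarith))) h
    · exact mul_nonpos_of_nonneg_of_nonpos
        (le_max_of_le_right (le_min (by norm_num) (by linarith))) h
  have hu2 : ∀ q : ℝ × ℝ, |q.2| ≤ 2 → u q = -q.2 / 2 := fun q hq => by
    obtain ⟨h1, h2⟩ := abs_le.1 hq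
    simp only [hudef]
    rw [min_eq_right (by linarith), max_eq_right (by linarith)]
  have hT : 0 ≤ 500 / ε := by positivity
  obtain ⟨x, y, hx0, hy0, hx, hy, hst⟩ := exists_feedback_path hε.le hT hu hu1 a b
  set T := 500 / ε with hTdef
  have hTm : T ∈ Icc 0 T := ⟨hT, le_rfl⟩
  have h0m : (0 : ℝ) ∈ Icc 0 T := ⟨le_rfl, hT⟩
  have hE' := fun t (ht : t ∈ Icc 0 T) => hasDerivAt_energy (hx t ht) (hy t ht)
  have hE1 : ∀ t ∈ Icc 0 T, energy (x t) (y t) ≤ 2 - Real.pi * ε / 4 := fun t ht => by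
    have := sub_le_of_hasDerivAt_le (c := 0) ht.1 (fun s hs => hE' s ⟨hs.1, hs.2.trans ht.2⟩)
      (fun s _ => by
        rw [mul_assoc]
        exact mul_nonpos_of_nonneg_of_nonpos hε.le (huy (x s, y s)))
    rw [hx0, hy0] at this
    linarith
  have hπε : 0 < Real.pi * ε := mul_pos Real.pi_pos hε
  have hπ3 : 3 * ε ≤ Real.pi * ε := mul_le_mul_of_nonneg_right Real.pi_gt_three.le hε.le
  have hxpi : ∀ t ∈ Icc 0 T, |x t| < Real.pi := abs_lt_pi_of_cos_ne
    (fun t ht => (hx t ht).continuousAt.continuousWithinAt) (by rwa [hx0])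
    (fun t ht h => by
      have := hE1 t ht
      unfold energy at this
      nlinarith [sq_nonneg (y t)])
  have hy2 : ∀ t ∈ Icc 0 T, |y t| ≤ 2 := fun t ht => by
    refine abs_le_of_sq_le_sq ?_ (by norm_num)
    have := hE1 t ht
    unfold energy at this
    nlinarith [Real.cos_le_one (x t)]
  have hex : ∃ t ∈ Icc 0 T, energy (x t) (y t) ≤ 1 := by
    by_contra! hcon
    set η : ℝ → ℝ := fun t => 2 - energy (x t) (y t) with hη
    set F : ℝ → ℝ := fun t => η t - ε / 16 * (x t * y t) with hF
    set F' : ℝ → ℝ := fun t => ε * y t ^ 2 / 2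
      - ε / 16 * (y t ^ 2 - x t * Real.sin (x t) - ε * (x t * y t) / 2) with hF'
    have hFd : ∀ t ∈ Icc 0 T, HasDerivAt F (F' t) t := fun t ht => by
      refine (((hE' t ht).const_sub 2).sub
        (((hx t ht).mul (hy t ht)).const_mul (ε / 16))).congr_deriv ?_
      rw [hu2 (x t, y t) (hy2 t ht)]
      simp only [hF']; ring
    have hly := fun t (ht : t ∈ Icc 0 T) => separatrix_lyapunov (F := F t) hε hε₁
      ((hxpi t ht).le.trans Real.pi_le_four) (hy2 t ht) (η := η t) (d := x t * Real.sin (x t))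
      (by simp only [hη]; linarith [hE1 t ht]) (by simp only [hη]; linarith [hcon t ht])
      (sqrt_le_sq_add_mul_sin rfl (by linarith [hcon t ht]) (hxpi t ht).le) rfl
    have hF0 : ε / 3 ≤ F 0 := by
      have h1 : x 0 * y 0 ≤ Real.pi * 2 := by
        refine (le_abs_self _).trans ?_
        rw [abs_mul]
        exact mul_le_mul (hxpi 0 h0m).le (hy2 0 h0m) (abs_nonneg _) Real.pi_pos.le
      have h2 := hE1 0 h0m
      simp only [hF, hη]
      nlinarith
    have hFm : ∀ t ∈ Icc 0 T, ε / 3 ≤ F t := fun t ht => by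
      have := sub_le_of_hasDerivAt_le (c := 0) ht.1
        (fun s hs => (hFd s ⟨hs.1, hs.2.trans ht.2⟩).neg)
        (fun s hs => neg_nonpos.2 (hly s ⟨hs.1, hs.2.trans ht.2⟩).1)
      simp only [Pi.neg_apply] at this
      linarith
    have hs := sub_le_of_hasDerivAt_le (c := -(ε / 200)) hT
      (fun t ht => ((hFd t ht).sqrt (by linarith [hFm t ht])).neg) (fun t ht => by
        have h1 := (hly t ht).2 (hFm t ht)
        have h2 : 0 < Real.sqrt (F t) := Real.sqrt_pos.2 (by linarith [hFm t ht])
        rw [neg_le_neg_iff, le_div_iff₀ (by positivity)]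
        simp only [hF']
        linarith)
    simp only [Pi.neg_apply] at hs
    have hεT : -(ε / 200) * T = -(5 / 2) := by rw [hTdef]; field_simp; norm_num
    have hFT : Real.sqrt (F T) ≤ 2 := by
      rw [Real.sqrt_le_left (by norm_num)]
      have h1 : -(8 : ℝ) ≤ x T * y T := by
        refine (abs_le.1 ?_).1
        rw [abs_mul]
        have := mul_le_mul ((hxpi T hTm).le.trans Real.pi_le_four) (hy2 T hTm) (abs_nonneg _)
          (by norm_num)
        linarith
      have h2 := hcon T hTm
      simp only [hF, hη]
      nlinarith
    linarith [Real.sqrt_nonneg (F 0)]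
  obtain ⟨t, ht, htE⟩ := hex
  have hfin := Damps.of_energy_le_one hε hε₁ (hxpi t ht) htE
  refine (Damps.of_steers (hst t ht) hfin).mono hε.le ?_
  have e : 600 / ε = T + 100 / ε := by rw [hTdef]; ring
  linarith [ht.2]

/-- Trajectories with a constant control; the energy is an affine function of the angle. -/
lemma exists_const_control_path {ε T c : ℝ} (hε : 0 ≤ ε) (hT : 0 ≤ T) (hc : |c| ≤ 1) (a b : ℝ) :
    ∃ x y : ℝ → ℝ, x 0 = a ∧ y 0 = b ∧ (∀ t ∈ Icc 0 T, HasDerivAt x (y t) t) ∧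
      (∀ t ∈ Icc 0 T, HasDerivAt y (-Real.sin (x t) + ε * c) t) ∧
      (∀ t ∈ Icc 0 T, Steers ε t (a, b) (x t, y t)) ∧
      ∀ t ∈ Icc 0 T, energy (x t) (y t) = energy a b + ε * c * (x t - a) := by
  obtain ⟨x, y, hx0, hy0, hx, hy, hst⟩ := exists_feedback_path hε hT
    (LocallyLipschitz.const c) (fun _ => hc) a b
  refine ⟨x, y, hx0, hy0, hx, hy, hst, fun t ht => ?_⟩
  have := abs_sub_le_of_hasDerivWithinAt (K := 0)
    (f := fun t => energy (x t) (y t) - ε * c * x t) (f' := fun _ => 0) (fun s hs => by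
      refine ((hasDerivAt_energy (hx s hs) (hy s hs)).sub
        ((hx s hs).const_mul (ε * c))).hasDerivWithinAt.congr_deriv ?_
      ring) (fun _ _ => by simp) ⟨le_rfl, hT⟩ ht
  rw [zero_mul, hx0, hy0] at this
  linarith [abs_nonpos_iff.1 this]

lemma exists_first_hit {T c : ℝ} {x y : ℝ → ℝ} (hx : ∀ t ∈ Icc 0 T, HasDerivAt x (y t) t)
    (h0 : x 0 < c) (hex : ∃ t ∈ Icc 0 T, c ≤ x t) : ∃ t ∈ Icc 0 T, x t = c ∧ 0 ≤ y t := by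
  by_contra! hcon
  obtain ⟨t₁, ht₁, hct₁⟩ := hex
  refine hct₁.not_gt (sub_pos.1 (pos_of_forall_ne_zero (f := fun t => c - x t)
    (fun t ht => (hx t ht).continuousAt.continuousWithinAt.const_sub c) (sub_pos.2 h0)
    (fun t ht hle hz => ?_) t₁ ht₁))
  have hxt : x t = c := (sub_eq_zero.1 hz).symm
  have ht0 : 0 < t := by
    rcases ht.1.eq_or_lt with h | h
    · rw [← h] at hxt; exact absurd hxt h0.ne
    · exact h
  refine (hcon t ht hxt).not_ge ?_
  have hslope := ((hasDerivAt_iff_tendsto_slope.1 (hx t ht)).mono_left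
    (nhdsWithin_mono t fun s (hs : s ∈ Iio t) => (ne_of_lt hs : s ≠ t)))
  refine ge_of_tendsto hslope ?_
  filter_upwards [Ioo_mem_nhdsLT ht0] with s hs
  rw [slope_def_field]
  exact div_nonneg_of_nonpos (by linarith [hle s ⟨hs.1.le, hs.2.le⟩]) (by linarith [hs.2])

/-- Half a rotation with the control `-1`. -/
lemma exists_steers_rotation {ε a b : ℝ} (hε : 0 < ε) (hε₁ : ε ≤ 1 / 10000)
    (ha : |a| ≤ Real.pi / 2) (hb : 0 < b) (hE : 2 - ε ≤ energy a b) :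
    ∃ T ≤ 20, ∃ b', Steers ε T (a, b) (3 * Real.pi / 4, b') ∧
      energy (3 * Real.pi / 4) b' = energy a b - ε * (3 * Real.pi / 4 - a) := by
  have hπ := Real.pi_gt_three
  have hπ' := Real.pi_lt_d2
  obtain ⟨ha1, ha2⟩ := abs_le.1 ha
  obtain ⟨x, y, hx0, hy0, hx, hy, hst, hen⟩ := exists_const_control_path (ε := ε) (T := 20) (c := -1)
    hε.le (by norm_num) (by norm_num) a b
  have hex : ∃ t ∈ Icc (0 : ℝ) 20, 3 * Real.pi / 4 ≤ x t := by
    by_contra! hcon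
    have hcos : ∀ r, |r| ≤ 3 * Real.pi / 4 → -(3 / 4) ≤ Real.cos r := fun r hr => by
      have h1 : Real.cos (3 * Real.pi / 4) ≤ Real.cos |r| :=
        Real.cos_le_cos_of_nonneg_of_le_pi (abs_nonneg _) (by linarith) hr
      rw [Real.cos_abs, show 3 * Real.pi / 4 = Real.pi - Real.pi / 4 by ring, Real.cos_pi_sub,
        Real.cos_pi_div_four] at h1
      have h2 : Real.sqrt 2 ≤ 3 / 2 := by
        rw [Real.sqrt_le_left (by norm_num)]; norm_num
      linarith
    have hge : ∀ t ∈ Icc (0 : ℝ) 20, a ≤ x t → 1 / 4 ≤ y t ^ 2 := fun t ht hat => by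
      have h1 := hen t ht
      have h2 := hcos (x t) (abs_le.2 ⟨by linarith, (hcon t ht).le⟩)
      have h3 := hcon t ht
      rw [energy] at h1
      nlinarith
    have hmono : ∀ t ∈ Icc (0 : ℝ) 20, (∀ s ∈ Icc 0 t, 0 ≤ y s) → a ≤ x t := fun t ht hs => by
      have := sub_le_of_hasDerivAt_le (c := 0) ht.1
        (fun s hs => (hx s ⟨hs.1, hs.2.trans ht.2⟩).neg) (fun s h => neg_nonpos.2 (hs s h))
      simp only [Pi.neg_apply, hx0] at this
      linarith
    have hypos := pos_of_forall_ne_zero (f := y) (T := 20)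
      (fun t ht => (hy t ht).continuousAt.continuousWithinAt) (by rwa [hy0])
      (fun t ht hs hz => by
        have := hge t ht (hmono t ht hs)
        rw [hz] at this; norm_num at this)
    have hfin := sub_le_of_hasDerivAt_le (T := 20) (c := -(1 / 2)) (by norm_num)
      (fun t ht => (hx t ht).neg) (fun t ht => by
        have h1 := hge t ht (hmono t ht fun s hs => (hypos s ⟨hs.1, hs.2.trans ht.2⟩).le)
        have h2 := hypos t ht
        nlinarith)
    simp only [Pi.neg_apply, hx0] at hfin
    have := hcon 20 ⟨by norm_num, le_rfl⟩
    linarith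
  obtain ⟨t, ht, hxt, -⟩ := exists_first_hit hx (by rw [hx0]; linarith) hex
  refine ⟨t, ht.2, y t, ?_, ?_⟩
  · rw [← hxt]; exact hst t ht
  · have := hen t ht
    rw [hxt] at this
    rw [this]; ring

/-- Escape from the neighbourhood of the upper equilibrium with the control `1`. -/
lemma exists_steers_escape {ε a b : ℝ} (hε : 0 < ε) (hε₁ : ε ≤ 1 / 10000)
    (ha1 : Real.pi / 2 < a) (ha2 : a < 3 * Real.pi / 2) (hw : 0 ≤ b + 2 * Real.sin ((a - Real.pi) / 2))
    (hE : energy a b ≤ 2) :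
    ∃ T ≤ 10 / ε, ∃ b' ≥ 0, Steers ε T (a, b) (3 * Real.pi / 2, b') ∧
      energy (3 * Real.pi / 2) b' = energy a b + ε * (3 * Real.pi / 2 - a) := by
  have hπ := Real.pi_gt_three
  have hπ' := Real.pi_lt_d2
  have hT : 0 ≤ 10 / ε := by positivity
  obtain ⟨x, y, hx0, hy0, hx, hy, hst, hen⟩ := exists_const_control_path (ε := ε) (T := 10 / ε)
    (c := 1) hε.le hT (by norm_num) a b
  set T := 10 / ε with hTdef
  have hex : ∃ t ∈ Icc 0 T, 3 * Real.pi / 2 ≤ x t := by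
    by_contra! hcon
    set w : ℝ → ℝ := fun t => y t + 2 * Real.sin ((x t - Real.pi) / 2) with hwdef
    have hwd : ∀ t ∈ Icc 0 T,
        HasDerivAt w (Real.cos ((x t - Real.pi) / 2) * w t + ε) t := fun t ht => by
      refine ((hy t ht).add (((((hx t ht).sub_const Real.pi).div_const 2).sin).const_mul
        2)).congr_deriv ?_
      have : Real.sin (x t) = -(2 * Real.sin ((x t - Real.pi) / 2)
          * Real.cos ((x t - Real.pi) / 2)) := by
        rw [← Real.sin_two_mul, mul_div_cancel₀ _ two_ne_zero, Real.sin_sub_pi, neg_neg]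
      simp only [hwdef]
      rw [this]; ring
    have hw0 : ∀ t ∈ Icc 0 T, 0 ≤ w t := fun t ht => by
      have := image_le_of_deriv_right_lt_deriv_boundary' (a := 0) (b := T) (f := fun t => -w t)
        (f' := fun t => -(Real.cos ((x t - Real.pi) / 2) * w t + ε)) (B := fun _ => 0)
        (B' := fun _ => 0) (fun t ht => (hwd t ht).neg.continuousAt.continuousWithinAt)
        (fun t ht => (hwd t ⟨ht.1, ht.2.le⟩).neg.hasDerivWithinAt)
        (by simp only [hwdef, hx0, hy0]; linarith) continuousOn_const
        (fun t _ => hasDerivWithinAt_const _ _ _) (fun t _ h => by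
          rw [neg_eq_zero.1 h]; linarith) ht
      linarith
    have hlow : ∀ t ∈ Icc 0 T, Real.pi / 2 ≤ x t := fun t ht => by
      have := image_le_of_deriv_right_lt_deriv_boundary' (a := 0) (b := T) (f := fun t => -x t)
        (f' := fun t => -y t) (B := fun _ => -(Real.pi / 2))
        (B' := fun _ => 0) (fun t ht => (hx t ht).neg.continuousAt.continuousWithinAt)
        (fun t ht => (hx t ⟨ht.1, ht.2.le⟩).neg.hasDerivWithinAt)
        (by rw [hx0]; linarith) continuousOn_const
        (fun t _ => hasDerivWithinAt_const _ _ _) (fun t ht h => by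
          have h1 := hw0 t ⟨ht.1, ht.2.le⟩
          have h2 : (x t - Real.pi) / 2 = -(Real.pi / 4) := by
            rw [neg_inj.1 h]; ring
          simp only [hwdef] at h1
          rw [h2, Real.sin_neg, Real.sin_pi_div_four] at h1
          have h3 : 0 < Real.sqrt 2 := by positivity
          linarith) ht
      linarith
    have hgrow := sub_le_of_hasDerivAt_le (c := -ε) hT (fun t ht => (hwd t ht).neg)
      (fun t ht => by
        have h1 : 0 ≤ Real.cos ((x t - Real.pi) / 2) :=
          Real.cos_nonneg_of_neg_pi_div_two_le_of_le (by linarith [hlow t ht])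
            (by linarith [hcon t ht])
        linarith [mul_nonneg h1 (hw0 t ht)])
    have hTm : T ∈ Icc 0 T := ⟨hT, le_rfl⟩
    have hεT : -ε * T = -10 := by rw [hTdef]; field_simp
    simp only [Pi.neg_apply] at hgrow
    have h0 := hw0 0 ⟨le_rfl, hT⟩
    have hyT : y T ≤ 4 := by
      refine (abs_le_of_sq_le_sq' ?_ (by norm_num)).2
      have h1 := hen T hTm
      have h2 := hcon T hTm
      rw [energy] at h1
      nlinarith [Real.cos_le_one (x T)]
    have hwT : w T ≤ y T + 2 := by
      simp only [hwdef]
      linarith [Real.sin_le_one ((x T - Real.pi) / 2)]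
    linarith
  obtain ⟨t, ht, hxt, hyt⟩ := exists_first_hit hx (by rwa [hx0]) hex
  refine ⟨t, ht.2, y t, hyt, ?_, ?_⟩
  · rw [← hxt]; exact hst t ht
  · have := hen t ht
    rw [hxt] at this
    rw [this]; ring

lemma Damps.of_rotation {ε a b : ℝ} (hε : 0 < ε) (hε₁ : ε ≤ 1 / 10000)
    (ha : |a| ≤ Real.pi / 2) (hb : 0 < b) (hE : 2 - ε ≤ energy a b)
    (hE' : energy a b - ε * (3 * Real.pi / 4 - a) ≤ 2 - Real.pi * ε / 4) :
    Damps ε (700 / ε) (a, b) := by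
  obtain ⟨T, hT, b', hst, hen⟩ := exists_steers_rotation hε hε₁ ha hb hE
  have hfin := Damps.of_energy_le_two_sub hε hε₁ (a := 3 * Real.pi / 4) (b := b')
    (by rw [abs_of_pos (by positivity)]; linarith [Real.pi_pos]) (hen ▸ hE')
  refine (Damps.of_steers hst hfin).mono hε.le ?_
  have h1 : 20 ≤ 100 / ε := by rw [le_div_iff₀ hε]; linarith
  have h2 : 700 / ε = 100 / ε + 600 / ε := by ring
  linarith

lemma Damps.of_escape {ε a b : ℝ} (hε : 0 < ε) (hε₁ : ε ≤ 1 / 10000)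
    (ha1 : Real.pi / 2 < a) (ha2 : a < 3 * Real.pi / 2)
    (hw : 0 ≤ b + 2 * Real.sin ((a - Real.pi) / 2)) (hE : energy a b ≤ 2)
    (hE' : 2 - ε ≤ energy a b) : Damps ε (800 / ε) (a, b) := by
  obtain ⟨T, hT, b', hb', hst, hen⟩ := exists_steers_escape hε hε₁ ha1 ha2 hw hE
  have hperiod : energy (-(Real.pi / 2)) b' = energy (3 * Real.pi / 2) b' := by
    unfold energy
    rw [← Real.cos_add_two_pi, show -(Real.pi / 2) + 2 * Real.pi = 3 * Real.pi / 2 by ring]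
  have hpos : 0 < ε * (3 * Real.pi / 2 - a) := mul_pos hε (by linarith)
  have hle : ε * (3 * Real.pi / 2 - a) ≤ ε * Real.pi :=
    mul_le_mul_of_nonneg_left (by linarith) hε.le
  have hb0 : 0 < b' := by
    refine lt_of_le_of_ne hb' fun h => ?_
    rw [← h] at hen hperiod
    have : energy (-(Real.pi / 2)) 0 = 1 := by simp [energy]
    linarith
  have hfin := Damps.of_rotation hε hε₁ (a := -(Real.pi / 2)) (b := b')
    (by rw [abs_neg, abs_of_pos Real.pi_div_two_pos]) hb0 (by linarith) (by linarith)
  rw [← Damps.add_int_iff 1, show -(Real.pi / 2) + ((1 : ℤ) : ℝ) * (2 * Real.pi)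
    = 3 * Real.pi / 2 by push_cast; ring] at hfin
  refine (Damps.of_steers hst hfin).mono hε.le ?_
  have h1 : 800 / ε = 100 / ε + 700 / ε := by ring
  have h2 : 10 / ε ≤ 100 / ε := by gcongr; norm_num
  linarith

lemma energy_neg (a b : ℝ) : energy (-a) (-b) = energy a b := by simp [energy]

lemma energy_add_int (a b : ℝ) (n : ℤ) : energy (a + n * (2 * Real.pi)) b = energy a b := by
  simp [energy, Real.cos_add_int_mul_two_pi]

lemma Damps.of_near_upper {ε a b : ℝ} (hε : 0 < ε) (hε₁ : ε ≤ 1 / 10000)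
    (ha1 : Real.pi / 2 < a) (ha2 : a < 3 * Real.pi / 2) (hE : energy a b ≤ 2)
    (hE' : 2 - ε ≤ energy a b) : Damps ε (800 / ε) (a, b) := by
  rcases le_total 0 (b + 2 * Real.sin ((a - Real.pi) / 2)) with hw | hw
  · exact Damps.of_escape hε hε₁ ha1 ha2 hw hE hE'
  · have e : energy (-a + ((1 : ℤ) : ℝ) * (2 * Real.pi)) (-b) = energy a b := by
      rw [energy_add_int, energy_neg]
    have := Damps.of_escape hε hε₁ (a := -a + ((1 : ℤ) : ℝ) * (2 * Real.pi)) (b := -b)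
      (by push_cast; linarith) (by push_cast; linarith) (by
        rw [show (-a + ((1 : ℤ) : ℝ) * (2 * Real.pi) - Real.pi) / 2 = -((a - Real.pi) / 2) by
          push_cast; ring, Real.sin_neg]
        linarith) (by rw [e]; exact hE) (by rw [e]; exact hE')
    rw [Damps.add_int_iff] at this
    simpa using this.neg

/-- Damping from inside the separatrix. -/
lemma Damps.of_energy_le_two {ε a b : ℝ} (hε : 0 < ε) (hε₁ : ε ≤ 1 / 10000)
    (hE : energy a b ≤ 2) : Damps ε (800 / ε) (a, b) := by
  obtain ⟨n, ⟨hn1, hn2⟩, -⟩ := existsUnique_add_zsmul_mem_Ico Real.two_pi_pos a (-(Real.pi / 2))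
  rw [zsmul_eq_mul] at hn1 hn2
  rw [← Damps.add_int_iff n]
  rw [← energy_add_int a b n] at hE
  set a' := a + n * (2 * Real.pi)
  have hπ := Real.pi_pos
  have h6 : 600 / ε ≤ 800 / ε := by gcongr; norm_num
  have h7 : 700 / ε ≤ 800 / ε := by gcongr; norm_num
  rcases le_or_gt (energy a' b) (2 - Real.pi * ε / 4) with hlow | hhigh
  · have hcos : Real.cos a' ≠ -1 := fun h => by
      unfold energy at hlow
      rw [h] at hlow
      nlinarith [sq_nonneg b, mul_pos hπ hε]
    rcases lt_trichotomy a' Real.pi with h | h | h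
    · exact (Damps.of_energy_le_two_sub hε hε₁ (abs_lt.2 ⟨by linarith, h⟩) hlow).mono hε.le h6
    · exact absurd (by rw [h, Real.cos_pi]) hcos
    · rw [← Damps.add_int_iff (-1)]
      refine (Damps.of_energy_le_two_sub hε hε₁ (abs_lt.2 ⟨?_, ?_⟩) ?_).mono hε.le h6
      · push_cast; linarith
      · push_cast; linarith
      · rw [energy_add_int]; exact hlow
  · have hE' : 2 - ε ≤ energy a' b := by nlinarith [Real.pi_le_four]
    rcases le_or_gt a' (Real.pi / 2) with h | h
    · have habs : |a'| ≤ Real.pi / 2 := abs_le.2 ⟨hn1, h⟩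
      have hcos : 0 ≤ Real.cos a' := Real.cos_nonneg_of_neg_pi_div_two_le_of_le hn1 h
      have hdrop : ∀ c ≤ Real.pi / 2, energy a' b - ε * (3 * Real.pi / 4 - c)
          ≤ 2 - Real.pi * ε / 4 := fun c hc => by
        have := mul_le_mul_of_nonneg_left hc hε.le
        linarith
      rcases lt_trichotomy b 0 with hb | hb | hb
      · have := Damps.of_rotation hε hε₁ (a := -a') (b := -b) (by rwa [abs_neg]) (neg_pos.2 hb)
          (by rwa [energy_neg]) (by rw [energy_neg]; exact hdrop _ (by linarith))
        simpa using (this.mono hε.le h7).neg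
      · rw [hb] at hE'
        unfold energy at hE'
        linarith
      · exact (Damps.of_rotation hε hε₁ habs hb hE' (hdrop _ h)).mono hε.le h7
    · exact Damps.of_near_upper hε hε₁ h (by linarith) hE hE'

lemma exists_steers_energy_le_two {ε a b M : ℝ} (hε : 0 < ε) (hM : 0 < M) (hb : 0 < b)
    (hbM : b ≤ M) :
    ∃ T ≤ 4 * M / ε, ∃ q : ℝ × ℝ, Steers ε T (a, b) q ∧ energy q.1 q.2 ≤ 2 := by
  have hT : 0 ≤ 4 * M / ε := by positivity
  obtain ⟨x, y, hx0, hy0, hx, hy, hst, -⟩ := exists_const_control_path (ε := ε) (c := -1)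
    hε.le hT (by norm_num) a b
  set T := 4 * M / ε with hTdef
  suffices hex : ∃ t ∈ Icc 0 T, energy (x t) (y t) ≤ 2 by
    obtain ⟨t, ht, hE⟩ := hex
    exact ⟨t, ht.2, _, hst t ht, hE⟩
  by_contra! hcon
  have hypos := pos_of_forall_ne_zero (f := y)
    (fun t ht => (hy t ht).continuousAt.continuousWithinAt) (by rwa [hy0])
    (fun t ht _ hz => by
      have := hcon t ht
      rw [hz] at this
      unfold energy at this
      linarith [Real.neg_one_le_cos (x t)])
  have hsqrt_le : ∀ t ∈ Icc 0 T, Real.sqrt (energy (x t) (y t) - 2) ≤ y t := fun t ht => by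
    rw [Real.sqrt_le_left (hypos t ht).le]
    unfold energy
    nlinarith [Real.neg_one_le_cos (x t), sq_nonneg (y t)]
  have hfin := sub_le_of_hasDerivAt_le (c := -(ε / 2)) hT
    (fun t ht => ((hasDerivAt_energy (hx t ht) (hy t ht)).sub_const 2).sqrt
      (sub_pos.2 (hcon t ht)).ne') (fun t ht => by
      have h1 := Real.sqrt_pos.2 (sub_pos.2 (hcon t ht))
      rw [div_le_iff₀ (by positivity)]
      nlinarith [hsqrt_le t ht])
  have h0 := (hsqrt_le 0 ⟨le_rfl, hT⟩).trans (hy0.le.trans hbM)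
  have hεT : -(ε / 2) * T = -(2 * M) := by rw [hTdef]; field_simp; norm_num
  linarith [Real.sqrt_nonneg (energy (x T) (y T) - 2)]

/-- Every state is damped in a time of order `1 / ε`. -/
lemma Damps.of_abs_le {ε a b M : ℝ} (hε : 0 < ε) (hε₁ : ε ≤ 1 / 10000) (hM : 0 < M)
    (hb : |b| ≤ M) : Damps ε ((4 * M + 800) / ε) (a, b) := by
  have pos : ∀ a b : ℝ, 0 < b → b ≤ M → Damps ε ((4 * M + 800) / ε) (a, b) := by
    intro a b hb hbM
    obtain ⟨T, hT, q, hst, hq⟩ := exists_steers_energy_le_two (a := a) hε hM hb hbM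
    refine (Damps.of_steers hst (Damps.of_energy_le_two hε hε₁ hq)).mono hε.le ?_
    rw [add_div]; linarith
  rcases lt_trichotomy b 0 with h | h | h
  · simpa using (pos (-a) (-b) (neg_pos.2 h) ((neg_le_abs b).trans hb)).neg
  · refine (Damps.of_energy_le_two hε hε₁ ?_).mono hε.le (by gcongr; linarith)
    rw [h]; unfold energy
    linarith [Real.neg_one_le_cos a]
  · exact pos a b h ((le_abs_self b).trans hb)

lemma steeringTimes_eq {ε : ℝ} (hε : 0 < ε) (p : PhaseSpace) :
    steeringTimes ε p = {T | Damps ε T (p.1.toReal, p.2)} := by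
  ext T
  have := mem_steeringTimes_iff hε (T := T) (p := (p.1.toReal, p.2))
  rwa [Real.Angle.coe_toReal] at this

lemma bddBelow_steeringTimes (ε : ℝ) (p : PhaseSpace) : BddBelow (steeringTimes ε p) :=
  ⟨0, fun _ hT => hT.1⟩

lemma isLeast_dampingTime {ε : ℝ} (hε : 0 < ε) {p : PhaseSpace}
    (hne : (steeringTimes ε p).Nonempty) : IsLeast (steeringTimes ε p) (dampingTime ε p) := by
  unfold dampingTime
  rw [steeringTimes_eq hε] at hne ⊢
  exact isLeast_csInf_damps hε.le hne

open Filter Topology in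
lemma upperSemicontinuousOn_dampingTime {ε : ℝ} (hε : 0 < ε) {K : Set PhaseSpace}
    (hne : ∀ p ∈ K, (steeringTimes ε p).Nonempty) :
    UpperSemicontinuousOn (dampingTime ε) K := by
  intro p hp c hc
  have hmem := (isLeast_dampingTime hε (hne p hp)).1
  rw [steeringTimes_eq hε] at hmem
  have hev := Damps.eventually hε (τ := (c - dampingTime ε p) / 2) (by linarith) hmem
  have hopen : IsOpenMap (Prod.map ((↑) : ℝ → Real.Angle) (id : ℝ → ℝ)) :=
    QuotientAddGroup.isOpenMap_coe.prodMap IsOpenMap.id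
  have hle := hopen.nhds_le (p.1.toReal, p.2)
  simp only [Prod.map_apply, Real.Angle.coe_toReal, id_eq] at hle
  have hev' : ∀ᶠ p' in 𝓝 p,
      dampingTime ε p + (c - dampingTime ε p) / 2 ∈ steeringTimes ε p' := by
    refine hle (eventually_map.2 ?_)
    filter_upwards [hev] with q hq
    exact (mem_steeringTimes_iff hε).2 hq
  refine (hev'.filter_mono nhdsWithin_le_nhds).mono fun p' hp' => ?_
  refine (csInf_le (bddBelow_steeringTimes ε p') hp').trans_lt ?_
  linarith

lemma energy_pos_of_ne {p : PhaseSpace} (hp : p ≠ ((0 : Real.Angle), (0 : ℝ))) :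
    0 < energy p.1.toReal p.2 := by
  refine lt_of_le_of_ne (energy_nonneg _ _) fun h => hp ?_
  unfold energy at h
  have hc := Real.cos_le_one p.1.toReal
  have h2 : p.2 = 0 := by
    have : p.2 ^ 2 = 0 := by nlinarith [sq_nonneg p.2]
    exact pow_eq_zero_iff two_ne_zero |>.1 this
  have h1 : Real.cos p.1.toReal = 1 := by nlinarith [sq_nonneg p.2]
  obtain ⟨n, hn⟩ := (Real.cos_eq_one_iff _).1 h1
  refine Prod.ext ?_ h2
  rw [← Real.Angle.coe_toReal p.1]
  exact Real.Angle.coe_eq_zero_iff.2 ⟨n, by simpa using hn⟩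

/-- The conclusion also records that, for the small `ε` in question, the minimum defining the
damping time and the maximum defining `T_ε(K)` are attained, so that no `sInf` or `sSup` below
takes a default value. -/
theorem mainTheorem4 (K : Set PhaseSpace) (hK : IsCompact K) (hne : K.Nonempty)
    (hK0 : K ≠ {((0 : Real.Angle), (0 : ℝ))}) :
    ∃ C₁ C₂ ε₀ : ℝ, 0 < C₁ ∧ 0 < C₂ ∧ 0 < ε₀ ∧
      ∀ ε : ℝ, 0 < ε → ε < ε₀ →
        (∀ p ∈ K, IsLeast (steeringTimes ε p) (dampingTime ε p)) ∧
        IsGreatest (dampingTime ε '' K) (maxDampingTime ε K) ∧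
        C₁ / ε ≤ maxDampingTime ε K ∧ maxDampingTime ε K ≤ C₂ / ε := by
  obtain ⟨M₀, hM₀⟩ := hK.exists_bound_of_continuousOn (f := fun p : PhaseSpace => p.2)
    continuous_snd.continuousOn
  set M := max M₀ 1
  have hM : 0 < M := lt_max_of_lt_right one_pos
  obtain ⟨p₀, hp₀, hp₀0⟩ : ∃ p ∈ K, p ≠ ((0 : Real.Angle), (0 : ℝ)) := by
    by_contra! hcon
    exact hK0 (hne.subset_singleton_iff.1 hcon)
  have he := energy_pos_of_ne hp₀0
  set e := energy p₀.1.toReal p₀.2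
  refine ⟨Real.sqrt (e / 2), 4 * M + 800, 1 / 10000, Real.sqrt_pos.2 (by positivity),
    by positivity, by norm_num, fun ε hε hε₁ => ?_⟩
  have hmem : ∀ p ∈ K, (4 * M + 800) / ε ∈ steeringTimes ε p := fun p hp => by
    rw [steeringTimes_eq hε]
    exact Damps.of_abs_le hε hε₁.le hM ((hM₀ p hp).trans (le_max_left _ _))
  have hleast : ∀ p ∈ K, IsLeast (steeringTimes ε p) (dampingTime ε p) := fun p hp =>
    isLeast_dampingTime hε ⟨_, hmem p hp⟩
  obtain ⟨m, hm, hmax⟩ := UpperSemicontinuousOn.exists_isMaxOn hne hK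
    (upperSemicontinuousOn_dampingTime hε fun p hp => ⟨_, hmem p hp⟩)
  have hgr : IsGreatest (dampingTime ε '' K) (dampingTime ε m) :=
    ⟨mem_image_of_mem _ hm, by rintro _ ⟨p, hp, rfl⟩; exact hmax hp⟩
  have heq : maxDampingTime ε K = dampingTime ε m := hgr.csSup_eq
  rw [heq]
  refine ⟨hleast, hgr, ?_, (hleast m hm).2 (hmem m hm)⟩
  refine le_trans ?_ (hmax hp₀ : dampingTime ε p₀ ≤ dampingTime ε m)
  have h0 := (hleast p₀ hp₀).1
  have h0' := h0.1
  rw [steeringTimes_eq hε] at h0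
  have h1 : e ≤ 2 * (ε * dampingTime ε p₀) ^ 2 := Damps.energy_le hε.le h0
  rw [div_le_iff₀ hε, mul_comm, Real.sqrt_le_left (mul_nonneg hε.le h0')]
  linarith
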